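/- Let $S_\infty$ denote the space of compact operators on the complex Hilbert space $\ell^2(\mathbb N)$ with the operator norm. With the Schur (entrywise, in the canonical basis) product of matrices it is a commutative, non-unital complex Banach algebra. A complex commutative Banach algebra is called a \emph{Q-algebra} if it is isomorphic (by a multiplicative linear homeomorphism) to a quotient $A/I$, where $A$ is a uniform algebra, i.e. a closed (not necessarily unital) subalgebra of $C(\Omega)$ for some compact Hausdorff space $\Omega$, and $I$ is a closed ideal of $A$. For integers $N,M$ and real coefficients $T=(T_{i_1\cdots i_N})_{1\le i_1,\dots,i_N\le M}$ put $$\|T\|=\max_{\epsilon^j_i=\pm1}\Big|\sum_{i_1,\dots,i_N}T_{i_1\cdots i_N}\,\epsilon^1_{i_1}\cdots\epsilon^N_{i_N}\Big| .$$ For a state (density matrix) $\rho$ on $(\mathbb C^D)^{\otimes N}$, the largest violation that $\rho$ can induce in a Bell inequality with an arbitrary number of dichotomic observables is $$\mathrm{LV}(\rho)=\sup\Big|\sum_{i_1,\dots,i_N}T_{i_1\cdots i_N}\,\operatorname{tr}\big(\rho\,A^1_{i_1}\otimes\cdots\otimes A^N_{i_N}\big)\Big|\in[0,\infty],$$ where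 the supremum is over all $M$, all real $T$ with $\|T\|=1$, and all Hermitian $D\times D$ matrices $A^j_i$ with $-\mathbb 1\le A^j_i\le\mathbb 1$ ($1\le j\le N$, $1\le i\le M$). \textbf{Theorem.} $S_\infty$ with the Schur product is a Q-algebra if and only if there is a constant $K\ge 0$ such that, for every $N\ge1$, every $D$ and every diagonal $N$-partite state, i.e. every unit vector $|\psi\rangle=\sum_{i=1}^D\alpha_i|ii\cdots i\rangle\in(\mathbb C^D)^{\otimes N}$ with $\alpha_i\in\mathbb C$, one has $\mathrm{LV}(|\psi\rangle\langle\psi|)\le K^N$. -/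

import Mathlib

open scoped ENNReal NNReal InnerProductSpace ComplexOrder

noncomputable section

/-! ### Compact operators on `ℓ²(ℕ)` with the Schur product -/

/-- The complex Hilbert space `ℓ²(ℕ)`. -/
abbrev Ell2 : Type := lp (fun _ : ℕ => ℂ) 2

namespace Ell2

/-- The `i`-th vector of the canonical orthonormal basis. -/
def e (i : ℕ) : Ell2 := lp.single 2 i (1 : ℂ)

/-- The `i`-th coordinate functional. -/
def coord (i : ℕ) : Ell2 →L[ℂ] ℂ := innerSL ℂ (e i)

/-- The matrix entry `⟨e i, A (e j)⟩` of a bounded operator. -/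
def entry (A : Ell2 →L[ℂ] Ell2) (i j : ℕ) : ℂ := A (e j) i

theorem norm_e (i : ℕ) : ‖e i‖ = 1 := by
  simp [e]

theorem coord_apply (i : ℕ) (x : Ell2) : coord i x = x i := by
  simp [coord, e, lp.inner_single_left]

theorem hasSum_sq (x : Ell2) : HasSum (fun i => ‖x i‖ ^ 2) (‖x‖ ^ 2) := by
  have h := lp.hasSum_norm (p := 2) (by norm_num) x
  simpa using h

theorem sum_sq_le (x : Ell2) (s : Finset ℕ) : ∑ i ∈ s, ‖x i‖ ^ 2 ≤ ‖x‖ ^ 2 :=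
  sum_le_hasSum s (fun _ _ => by positivity) (hasSum_sq x)

theorem norm_entry_le (A : Ell2 →L[ℂ] Ell2) (i j : ℕ) : ‖entry A i j‖ ≤ ‖A‖ := by
  have h1 : ‖entry A i j‖ ≤ ‖A (e j)‖ := lp.norm_apply_le_norm (by norm_num) _ i
  have h2 := A.le_opNorm (e j)
  rw [norm_e, mul_one] at h2
  exact h1.trans h2

theorem sum_entry_sq_le (A : Ell2 →L[ℂ] Ell2) (s : Finset ℕ) (j : ℕ) :
    ∑ i ∈ s, ‖entry A i j‖ ^ 2 ≤ ‖A‖ ^ 2 := by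
  have h2 := A.le_opNorm (e j)
  rw [norm_e, mul_one] at h2
  exact (sum_sq_le (A (e j)) s).trans (by gcongr)

theorem adjoint_apply (A : Ell2 →L[ℂ] Ell2) (i j : ℕ) :
    (ContinuousLinearMap.adjoint A (e i)) j = star (entry A i j) := by
  have h : ⟪ContinuousLinearMap.adjoint A (e i), e j⟫_ℂ = ⟪e i, A (e j)⟫_ℂ :=
    ContinuousLinearMap.adjoint_inner_left A (e j) (e i)
  have h1 : ⟪ContinuousLinearMap.adjoint A (e i), e j⟫_ℂ
      = star ((ContinuousLinearMap.adjoint A (e i)) j) := by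
    rw [← inner_conj_symm]
    exact congrArg star (coord_apply j (ContinuousLinearMap.adjoint A (e i)))
  have h2 : ⟪e i, A (e j)⟫_ℂ = entry A i j := coord_apply i _
  rw [h1, h2] at h
  rw [← h, star_star]

theorem hasSum_e (x : Ell2) : HasSum (fun j => x j • e j) x := by
  have h := lp.hasSum_single (p := 2) (by norm_num) x
  convert h using 2 with j
  rw [e, ← lp.single_smul]
  simp

theorem apply_eq_tsum (A : Ell2 →L[ℂ] Ell2) (x : Ell2) (i : ℕ) :
    A x i = ∑' j, entry A i j * x j := by
  have h := ((hasSum_e x).mapL A).mapL (coord i)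
  rw [← coord_apply i (A x), ← h.tsum_eq]
  refine tsum_congr fun j => ?_
  rw [map_smul, map_smul, coord_apply, smul_eq_mul, mul_comm, entry]

theorem ext_entry {A B : Ell2 →L[ℂ] Ell2} (h : ∀ i j, entry A i j = entry B i j) : A = B := by
  ext x i
  simp only [apply_eq_tsum, h]

/-- The vector `(b i j * x j)_j`. -/
def rowMul (B : Ell2 →L[ℂ] Ell2) (x : Ell2) (i : ℕ) : Ell2 :=
  ⟨fun j => entry B i j * x j, by
    refine memℓp_gen' (C := ‖B‖ ^ 2 * ‖x‖ ^ 2) fun s => ?_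
    have : ∀ j ∈ s, ‖entry B i j * x j‖ ^ (2 : ℝ≥0∞).toReal ≤ ‖B‖ ^ 2 * ‖x j‖ ^ 2 := by
      intro j _
      have := norm_entry_le B i j
      simp only [ENNReal.toReal_ofNat, Real.rpow_ofNat, norm_mul, mul_pow]
      gcongr
    refine (Finset.sum_le_sum this).trans ?_
    rw [← Finset.mul_sum]
    gcongr
    exact sum_sq_le x s⟩

theorem rowMul_apply (B : Ell2 →L[ℂ] Ell2) (x : Ell2) (i j : ℕ) :
    rowMul B x i j = entry B i j * x j := rfl

/-- The function `i ↦ ∑' j, a i j * b i j * x j`. -/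
def schurFun (A B : Ell2 →L[ℂ] Ell2) (x : Ell2) (i : ℕ) : ℂ :=
  ∑' j, entry A i j * entry B i j * x j

theorem hasSum_schurFun (A B : Ell2 →L[ℂ] Ell2) (x : Ell2) (i : ℕ) :
    HasSum (fun j => entry A i j * entry B i j * x j)
      ⟪ContinuousLinearMap.adjoint A (e i), rowMul B x i⟫_ℂ := by
  have h := lp.hasSum_inner (𝕜 := ℂ) (ContinuousLinearMap.adjoint A (e i)) (rowMul B x i)
  have hf : (fun j => entry A i j * entry B i j * x j) = fun j =>
      ⟪ContinuousLinearMap.adjoint A (e i) j, rowMul B x i j⟫_ℂ := by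
    funext j
    rw [adjoint_apply, rowMul_apply]
    simp only [RCLike.inner_apply, starRingEnd_apply, star_star]
    ring
  rw [hf]
  exact h

theorem norm_schurFun_sq_le (A B : Ell2 →L[ℂ] Ell2) (x : Ell2) (i : ℕ) :
    ‖schurFun A B x i‖ ^ 2 ≤ ‖A‖ ^ 2 * ‖rowMul B x i‖ ^ 2 := by
  rw [schurFun, (hasSum_schurFun A B x i).tsum_eq, ← mul_pow]
  gcongr
  refine (norm_inner_le_norm _ _).trans ?_
  gcongr
  have h := (ContinuousLinearMap.adjoint A).le_opNorm (e i)
  rw [norm_e, mul_one, LinearIsometryEquiv.norm_map] at h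
  exact h

theorem sum_schurFun_sq_le (A B : Ell2 →L[ℂ] Ell2) (x : Ell2) (s : Finset ℕ) :
    ∑ i ∈ s, ‖schurFun A B x i‖ ^ 2 ≤ (‖A‖ * ‖B‖ * ‖x‖) ^ 2 := by
  calc ∑ i ∈ s, ‖schurFun A B x i‖ ^ 2
      ≤ ∑ i ∈ s, ‖A‖ ^ 2 * ‖rowMul B x i‖ ^ 2 :=
        Finset.sum_le_sum fun i _ => norm_schurFun_sq_le A B x i
    _ = ‖A‖ ^ 2 * ∑ i ∈ s, ‖rowMul B x i‖ ^ 2 := by rw [Finset.mul_sum]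
    _ ≤ ‖A‖ ^ 2 * (‖B‖ ^ 2 * ‖x‖ ^ 2) := by
        gcongr
        refine hasSum_le (fun j => ?_) (hasSum_sum fun i _ => hasSum_sq (rowMul B x i))
          ((hasSum_sq x).mul_left (‖B‖ ^ 2))
        simp only [rowMul_apply, norm_mul, mul_pow]
        rw [← Finset.sum_mul]
        gcongr
        exact sum_entry_sq_le B s j
    _ = (‖A‖ * ‖B‖ * ‖x‖) ^ 2 := by ring

/-- The Schur (entrywise) product of two bounded operators on `ℓ²(ℕ)`: the operator whose matrix
is the entrywise product of the two matrices. -/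
def schur (A B : Ell2 →L[ℂ] Ell2) : Ell2 →L[ℂ] Ell2 :=
  LinearMap.mkContinuous
    { toFun := fun x => ⟨schurFun A B x, by
        refine memℓp_gen' (C := (‖A‖ * ‖B‖ * ‖x‖) ^ 2) fun s => ?_
        simpa using sum_schurFun_sq_le A B x s⟩
      map_add' := fun x y => by
        ext i
        change schurFun A B (x + y) i = schurFun A B x i + schurFun A B y i
        simp only [schurFun]
        rw [← ((hasSum_schurFun A B x i).summable).tsum_add ((hasSum_schurFun A B y i).summable)]
        exact tsum_congr fun j => mul_add _ _ _
      map_smul' := fun c x => by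
        ext i
        change schurFun A B (c • x) i = c * schurFun A B x i
        simp only [schurFun]
        rw [← tsum_mul_left]
        refine tsum_congr fun j => ?_
        change _ * (c * x j) = _
        ring } (‖A‖ * ‖B‖) fun x => by
    refine le_of_sq_le_sq ?_ (by positivity)
    refine hasSum_le_of_sum_le (hasSum_sq _) fun s => ?_
    exact sum_schurFun_sq_le A B x s

theorem norm_schur_le (A B : Ell2 →L[ℂ] Ell2) : ‖schur A B‖ ≤ ‖A‖ * ‖B‖ :=
  LinearMap.mkContinuous_norm_le _ (by positivity) _

theorem entry_schur (A B : Ell2 →L[ℂ] Ell2) (i j : ℕ) :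
    entry (schur A B) i j = entry A i j * entry B i j := by
  change ∑' k, entry A i k * entry B i k * (e j) k = _
  rw [tsum_eq_single j]
  · simp [e]
  · intro k hk
    simp [e, hk]

theorem entry_add (A B : Ell2 →L[ℂ] Ell2) (i j : ℕ) :
    entry (A + B) i j = entry A i j + entry B i j := rfl

theorem entry_sub (A B : Ell2 →L[ℂ] Ell2) (i j : ℕ) :
    entry (A - B) i j = entry A i j - entry B i j := rfl

theorem entry_smul (c : ℂ) (A : Ell2 →L[ℂ] Ell2) (i j : ℕ) :
    entry (c • A) i j = c * entry A i j := rfl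

theorem entry_zero (i j : ℕ) : entry 0 i j = 0 := rfl

/-- The orthogonal projection onto the span of the first `n` basis vectors. -/
def trunc (n : ℕ) : Ell2 →L[ℂ] Ell2 :=
  ∑ i ∈ Finset.range n, (coord i).smulRight (e i)

theorem trunc_apply (n : ℕ) (x : Ell2) : trunc n x = ∑ i ∈ Finset.range n, x i • e i := by
  simp [trunc, coord_apply]

theorem trunc_coord (n : ℕ) (x : Ell2) (i : ℕ) :
    trunc n x i = if i < n then x i else 0 := by
  rw [← coord_apply, trunc_apply, map_sum]
  simp only [map_smul, coord_apply, e, smul_eq_mul, lp.single_apply, Pi.single_apply]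
  simp

theorem tendsto_trunc (x : Ell2) :
    Filter.Tendsto (fun n => trunc n x) Filter.atTop (nhds x) := by
  simp only [trunc_apply]
  exact (hasSum_e x).tendsto_sum_nat

theorem norm_trunc_le (n : ℕ) (x : Ell2) : ‖trunc n x‖ ≤ ‖x‖ := by
  refine le_of_sq_le_sq ?_ (norm_nonneg _)
  refine hasSum_le (fun i => ?_) (hasSum_sq (trunc n x)) (hasSum_sq x)
  rw [trunc_coord]
  split_ifs
  · exact le_rfl
  · simp

theorem isCompactOperator_trunc (n : ℕ) : IsCompactOperator (trunc n) := by
  have : trunc n ∈ compactOperator (RingHom.id ℂ) Ell2 Ell2 := by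
    refine Submodule.sum_mem _ fun i _ => ?_
    change IsCompactOperator _
    have h : IsCompactOperator (coord i) :=
      isCompactOperator_of_locallyCompactSpace_dom (coord i)
    exact h.clm_comp (ContinuousLinearMap.toSpanSingleton ℂ (e i))
  exact this

theorem tendsto_trunc_comp {A : Ell2 →L[ℂ] Ell2} (hA : IsCompactOperator A) :
    Filter.Tendsto (fun n => trunc n ∘L A) Filter.atTop (nhds A) := by
  rw [Metric.tendsto_atTop]
  intro ε hε
  have hK := hA.isCompact_closure_image_closedBall (1 : ℝ)
  obtain ⟨t, -, htf, hts⟩ := hK.finite_cover_balls (e := ε / 4) (by positivity)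
  have h1 : ∀ᶠ n in Filter.atTop, ∀ y ∈ t, dist (trunc n y) y < ε / 4 := by
    rw [htf.eventually_all]
    intro y _
    exact (tendsto_trunc y).eventually (Metric.ball_mem_nhds y (by positivity))
  obtain ⟨n₀, hn₀⟩ := Filter.eventually_atTop.1 h1
  refine ⟨n₀, fun n hn => ?_⟩
  rw [dist_eq_norm]
  refine lt_of_le_of_lt (b := 3 * (ε / 4)) ?_ (by linarith)
  refine ContinuousLinearMap.opNorm_le_of_unit_norm (𝕜 := ℂ) (by positivity) fun x hx => ?_
  have hx' : A x ∈ closure (A '' Metric.closedBall 0 1) :=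
    subset_closure ⟨x, by simp [hx], rfl⟩
  obtain ⟨y, hy, hxy⟩ := Set.mem_iUnion₂.1 (hts hx')
  have h2 := hn₀ n hn y hy
  rw [Metric.mem_ball, dist_eq_norm] at hxy
  rw [dist_eq_norm] at h2
  have h3 := norm_trunc_le n (A x - y)
  have h4 : (trunc n ∘L A - A) x = trunc n (A x - y) + (trunc n y - y) - (A x - y) := by
    simp
  rw [h4]
  have h5 := norm_sub_le (trunc n (A x - y) + (trunc n y - y)) (A x - y)
  have h6 := norm_add_le (trunc n (A x - y)) (trunc n y - y)
  linarith

theorem isCompactOperator_schur {A : Ell2 →L[ℂ] Ell2} (hA : IsCompactOperator A)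
    (B : Ell2 →L[ℂ] Ell2) : IsCompactOperator (schur A B) := by
  have key : ∀ n, trunc n ∘L schur A B = schur (trunc n ∘L A) B := by
    intro n
    refine ext_entry fun i j => ?_
    have h : ∀ C : Ell2 →L[ℂ] Ell2, entry (trunc n ∘L C) i j = if i < n then entry C i j else 0 :=
      fun C => trunc_coord n (C (e j)) i
    rw [entry_schur, h, h, entry_schur]
    split_ifs <;> simp
  have hsub : ∀ n, schur (trunc n ∘L A) B - schur A B = schur (trunc n ∘L A - A) B := by
    intro n
    refine ext_entry fun i j => ?_
    simp only [entry_sub, entry_schur, sub_mul]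
  have hlim : Filter.Tendsto (fun n => trunc n ∘L schur A B) Filter.atTop (nhds (schur A B)) := by
    rw [tendsto_iff_norm_sub_tendsto_zero]
    have h0 := (tendsto_iff_norm_sub_tendsto_zero.1 (tendsto_trunc_comp hA)).mul_const ‖B‖
    rw [zero_mul] at h0
    refine squeeze_zero (fun n => norm_nonneg _) (fun n => ?_) h0
    rw [key, hsub]
    exact norm_schur_le _ _
  refine isCompactOperator_of_tendsto hlim (Filter.Eventually.of_forall fun n => ?_)
  exact (isCompactOperator_trunc n).comp_clm (schur A B)

end Ell2

/-- `S_∞`: the space of compact operators on `ℓ²(ℕ)`, with the operator norm. -/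
def SInfty : Type := ↥(compactOperator (RingHom.id ℂ) Ell2 Ell2)

namespace SInfty

instance : NormedAddCommGroup SInfty :=
  inferInstanceAs (NormedAddCommGroup ↥(compactOperator (RingHom.id ℂ) Ell2 Ell2))

instance : NormedSpace ℂ SInfty :=
  inferInstanceAs (NormedSpace ℂ ↥(compactOperator (RingHom.id ℂ) Ell2 Ell2))

instance : CompleteSpace SInfty := by
  have h : IsClosed ((compactOperator (RingHom.id ℂ) Ell2 Ell2 :
      Submodule ℂ (Ell2 →L[ℂ] Ell2)) : Set (Ell2 →L[ℂ] Ell2)) :=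
    isClosed_setOfPred_isCompactOperator
  exact h.completeSpace_coe

/-- The underlying bounded operator. -/
def toCLM (A : SInfty) : Ell2 →L[ℂ] Ell2 := A.1

/-- The product of `S_∞` is the Schur product. -/
instance : Mul SInfty :=
  ⟨fun A B => ⟨Ell2.schur A.1 B.1, Ell2.isCompactOperator_schur A.2 B.1⟩⟩

theorem ext_entry {A B : SInfty}
    (h : ∀ i j, Ell2.entry A.toCLM i j = Ell2.entry B.toCLM i j) : A = B :=
  Subtype.ext (Ell2.ext_entry h)

theorem norm_def (A : SInfty) : ‖A‖ = ‖A.toCLM‖ := rfl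

theorem entry_mul (A B : SInfty) (i j : ℕ) :
    Ell2.entry (A * B).toCLM i j = Ell2.entry A.toCLM i j * Ell2.entry B.toCLM i j :=
  Ell2.entry_schur A.1 B.1 i j

theorem entry_add (A B : SInfty) (i j : ℕ) :
    Ell2.entry (A + B).toCLM i j = Ell2.entry A.toCLM i j + Ell2.entry B.toCLM i j := rfl

theorem entry_smul (c : ℂ) (A : SInfty) (i j : ℕ) :
    Ell2.entry (c • A).toCLM i j = c * Ell2.entry A.toCLM i j := rfl

theorem entry_zero (i j : ℕ) : Ell2.entry (0 : SInfty).toCLM i j = 0 := rfl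

/-- `S_∞` with the Schur product is a commutative Banach algebra (without unit). -/
instance : NonUnitalNormedCommRing SInfty :=
  { (inferInstance : NormedAddCommGroup SInfty), (inferInstance : Mul SInfty) with
    left_distrib := fun A B C => ext_entry fun i j => by
      simp only [entry_mul, entry_add, mul_add]
    right_distrib := fun A B C => ext_entry fun i j => by
      simp only [entry_mul, entry_add, add_mul]
    zero_mul := fun A => ext_entry fun i j => by
      simp only [entry_mul, entry_zero, zero_mul]
    mul_zero := fun A => ext_entry fun i j => by
      simp only [entry_mul, entry_zero, mul_zero]
    mul_assoc := fun A B C => ext_entry fun i j => by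
      simp only [entry_mul, mul_assoc]
    mul_comm := fun A B => ext_entry fun i j => by
      simp only [entry_mul, mul_comm]
    norm_mul_le := fun A B => Ell2.norm_schur_le A.1 B.1 }

instance : IsScalarTower ℂ SInfty SInfty :=
  ⟨fun c A B => ext_entry fun i j => by
    simp only [smul_eq_mul, entry_mul, entry_smul, mul_assoc]⟩

instance : SMulCommClass ℂ SInfty SInfty :=
  ⟨fun c A B => ext_entry fun i j => by
    simp only [smul_eq_mul, entry_mul, entry_smul, mul_left_comm]⟩

end SInfty

/-! ### Q-algebras -/

/-- A complex commutative Banach algebra `X` is a Q-algebra if it is isomorphic, as a Banach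
algebra, to a quotient `A / I` of a uniform algebra. Here a uniform algebra `A` is a closed (not
necessarily unital) subalgebra of `C(K)` for a compact Hausdorff space `K`, `I` is a closed ideal
of `A`, `A ⧸ I` carries the quotient norm, and an isomorphism is a linear homeomorphism `Φ` that is
multiplicative for the product `[a] [b] = [a * b]` of the quotient algebra. -/
def IsQAlgebra.{u} (X : Type u) [NonUnitalNormedCommRing X] [NormedSpace ℂ X]
    [IsScalarTower ℂ X X] [SMulCommClass ℂ X X] [CompleteSpace X] : Prop :=
  ∃ (K : Type u) (_ : TopologicalSpace K) (_ : CompactSpace K) (_ : T2Space K)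
    (A : NonUnitalSubalgebra ℂ C(K, ℂ)) (I : Submodule ℂ A),
    IsClosed (A : Set C(K, ℂ)) ∧ IsClosed (I : Set A) ∧
    (∀ a : A, ∀ b ∈ I, a * b ∈ I) ∧
    ∃ Φ : (A ⧸ I) ≃L[ℂ] X,
      ∀ a b : A, Φ (Submodule.Quotient.mk (a * b)) =
        Φ (Submodule.Quotient.mk a) * Φ (Submodule.Quotient.mk b)

/-! ### Bell inequalities and their violation -/

namespace Bell

/-- The classical (local hidden variable) value `‖T‖` of the Bell functional with real coefficients
`T`, for `N` observers with `M` dichotomic observables each: the maximum over all deterministic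
assignments of outcomes `±1`. -/
def classicalValue {N M : ℕ} (T : (Fin N → Fin M) → ℝ) : ℝ :=
  ⨆ ε : Fin N → Fin M → ℤˣ, |∑ i : Fin N → Fin M, T i * ∏ j, ((ε j (i j) : ℤ) : ℝ)|

/-- The tensor product `A 1 ⊗ ⋯ ⊗ A N` of `D × D` matrices, as a matrix on `(ℂ^D)^{⊗ N}`, whose
canonical basis `|s 1 … s N⟩` is indexed by the functions `s : Fin N → Fin D`. -/
def tensor {N D : ℕ} (A : Fin N → Matrix (Fin D) (Fin D) ℂ) :
    Matrix (Fin N → Fin D) (Fin N → Fin D) ℂ :=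
  Matrix.of fun s t => ∏ j, A j (s j) (t j)

/-- The density matrix `|ψ⟩⟨ψ|` of a vector `ψ` of `(ℂ^D)^{⊗ N}`. -/
def pureState {N D : ℕ} (ψ : EuclideanSpace ℂ (Fin N → Fin D)) :
    Matrix (Fin N → Fin D) (Fin N → Fin D) ℂ :=
  Matrix.of fun s t => ψ s * star (ψ t)

/-- The vector `∑ i, α i |i i ⋯ i⟩` of `(ℂ^D)^{⊗ N}`. -/
def diagonalVector (N : ℕ) {D : ℕ} (α : Fin D → ℂ) : EuclideanSpace ℂ (Fin N → Fin D) :=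
  ∑ i, α i • EuclideanSpace.single (fun _ : Fin N => i) (1 : ℂ)

/-- A dichotomic observable: a Hermitian matrix `A` with `-1 ≤ A ≤ 1`. -/
def IsDichotomic {D : ℕ} (A : Matrix (Fin D) (Fin D) ℂ) : Prop :=
  A.IsHermitian ∧ (1 - A).PosSemidef ∧ (1 + A).PosSemidef

/-- The quantum value of the Bell functional `T` in the state `ρ` when observer `j` measures the
observables `A j 1, …, A j M`. -/
def quantumValue {N M D : ℕ} (T : (Fin N → Fin M) → ℝ)
    (ρ : Matrix (Fin N → Fin D) (Fin N → Fin D) ℂ)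
    (A : Fin N → Fin M → Matrix (Fin D) (Fin D) ℂ) : ℝ :=
  ‖∑ i : Fin N → Fin M, (T i : ℂ) * Matrix.trace (ρ * tensor fun j => A j (i j))‖

/-- The largest violation that the state `ρ` can induce in a Bell inequality, with an arbitrary
number `M` of dichotomic observables per site: the supremum of the quantum value over all Bell
functionals of classical value `1` and all choices of dichotomic observables. -/
def largestViolation {N D : ℕ} (ρ : Matrix (Fin N → Fin D) (Fin N → Fin D) ℂ) : ℝ≥0∞ :=
  ⨆ (M : ℕ) (T : (Fin N → Fin M) → ℝ) (_ : classicalValue T = 1)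
    (A : Fin N → Fin M → Matrix (Fin D) (Fin D) ℂ) (_ : ∀ j m, IsDichotomic (A j m)),
    ENNReal.ofReal (quantumValue T ρ A)

end Bell

end

open scoped Matrix

noncomputable section

/-! ### Multilinear forms on cubes and polydiscs -/

namespace Bell

/-! The link between the two sides is that a diagonal state only sees the entries of `A^1 ⊗ ⋯ ⊗ A^N`
at constant multi-indices `(s,…,s), (t,…,t)`, and such an entry is the product of the entries `A^j s
t`. Hence the quantum value is `|⟨α, B α⟩|`, where `B = ∑ T_i A^1_{i_1} ⋯ A^N_{i_N}` is computed
with the Schur product (`quantumValue_diagonalVector`). The question becomes whether bounded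
multilinear forms act on the unit ball of `S_∞` with a geometric bound.

If `S_∞` is a quotient of a uniform algebra, contractions lift to functions of norm at most `R`. The
form evaluated at the lifts is bounded pointwise by `(2R)^N ‖T‖`, the factor `2^N` paying for
complex arguments in a real form, and the multiplicative quotient map sends it to `B`
(`IsQAlgebra.exists_norm_le`).

Conversely, the self-adjoint dilation turns contractions into dichotomic observables, and the
diagonal state of `u ⊕ v` recovers `2 Re ⟨u, B v⟩` (`quantumValue_dilation`). Rotating the phase and
splitting complex coefficients gives `DavieCondition`. That condition implies being a Q-algebra
(`DavieCondition.isQAlgebra`): polarization costs `e^n` in degree `n`, so after shrinking the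
variables by a fixed `δ` the homogeneous parts of a polynomial sum geometrically, and `P ↦ P(δ x)`
is contractive for the sup norm on a polydisc. Its closure is a homomorphism from a uniform algebra
onto the whole algebra. -/

theorem le_classicalValue {N M : ℕ} (T : (Fin N → Fin M) → ℝ) (ε : Fin N → Fin M → ℤˣ) :
    |∑ i : Fin N → Fin M, T i * ∏ j, ((ε j (i j) : ℤ) : ℝ)| ≤ classicalValue T :=
  le_ciSup (f := fun ε : Fin N → Fin M → ℤˣ =>
    |∑ i : Fin N → Fin M, T i * ∏ j, ((ε j (i j) : ℤ) : ℝ)|) (Set.finite_range _).bddAbove ε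

theorem classicalValue_nonneg {N M : ℕ} (T : (Fin N → Fin M) → ℝ) : 0 ≤ classicalValue T :=
  (abs_nonneg _).trans (le_classicalValue T 1)

/-- The probability of `u` for a `±1`-valued random variable of mean `y`. -/
def signWeight (y : ℝ) (u : ℤˣ) : ℝ := (1 + ((u : ℤ) : ℝ) * y) / 2

theorem sum_signWeight (y : ℝ) : ∑ u, signWeight y u = 1 := by
  simp [signWeight]; ring

theorem sum_signWeight_mul (y : ℝ) : ∑ u : ℤˣ, signWeight y u * ((u : ℤ) : ℝ) = y := by
  simp [signWeight]; ring

theorem signWeight_nonneg {y : ℝ} (hy : |y| ≤ 1) (u : ℤˣ) : 0 ≤ signWeight y u := by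
  have := abs_le.1 hy
  rcases Int.units_eq_one_or u with rfl | rfl <;> simp [signWeight] <;> linarith

theorem sum_prod_signWeight_mul {M : ℕ} (y : Fin M → ℝ) (k : Fin M) :
    ∑ e : Fin M → ℤˣ, (∏ i, signWeight (y i) (e i)) * ((e k : ℤ) : ℝ) = y k := by
  have h : ∀ e : Fin M → ℤˣ, (∏ i, signWeight (y i) (e i)) * ((e k : ℤ) : ℝ)
      = ∏ i, signWeight (y i) (e i) * (if i = k then ((e i : ℤ) : ℝ) else 1) := by
    intro e
    rw [Finset.prod_mul_distrib, Finset.prod_ite_eq' Finset.univ k]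
    simp
  simp_rw [h]
  rw [← Fintype.piFinset_univ (α := Fin M) (β := fun _ => ℤˣ), ← Finset.prod_univ_sum (fun _ => Finset.univ)
    (fun i (u : ℤˣ) => signWeight (y i) u * (if i = k then ((u : ℤ) : ℝ) else 1))]
  rw [Finset.prod_eq_single k]
  · simp only [if_true, sum_signWeight_mul]
  · intro i _ hi
    simp only [hi, if_false, mul_one, sum_signWeight]
  · simp

theorem sum_prod_signWeight {M : ℕ} (y : Fin M → ℝ) :
    ∑ e : Fin M → ℤˣ, (∏ i, signWeight (y i) (e i)) = 1 := by
  rw [← Fintype.piFinset_univ (α := Fin M) (β := fun _ => ℤˣ),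
    ← Finset.prod_univ_sum (fun _ => Finset.univ) (fun i (u : ℤˣ) => signWeight (y i) u)]
  simp only [sum_signWeight, Finset.prod_const_one]

/-- A point of the cube is the mean of independent random signs, and a multilinear form commutes
with this expectation; so its values on the cube are averages of its values at sign vectors. -/
theorem abs_sum_le_classicalValue {N M : ℕ} (T : (Fin N → Fin M) → ℝ) {y : Fin N → Fin M → ℝ}
    (hy : ∀ j i, |y j i| ≤ 1) : |∑ i, T i * ∏ j, y j (i j)| ≤ classicalValue T := by
  set w : (Fin N → Fin M → ℤˣ) → ℝ := fun ε => ∏ j, ∏ i, signWeight (y j i) (ε j i) with hw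
  have hw0 : ∀ ε, 0 ≤ w ε := fun ε =>
    Finset.prod_nonneg fun j _ => Finset.prod_nonneg fun i _ => signWeight_nonneg (hy j i) _
  have hpi := Fintype.piFinset_univ (α := Fin N) (β := fun _ => Fin M → ℤˣ)
  have hw1 : ∑ ε, w ε = 1 := by
    rw [← hpi, ← Finset.prod_univ_sum (fun _ => Finset.univ)
      (fun j (e : Fin M → ℤˣ) => ∏ i, signWeight (y j i) (e i))]
    simp [sum_prod_signWeight]
  have hmean : ∀ i : Fin N → Fin M,
      ∏ j, y j (i j) = ∑ ε, w ε * ∏ j, ((ε j (i j) : ℤ) : ℝ) := by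
    intro i
    simp_rw [hw, ← Finset.prod_mul_distrib]
    rw [← hpi, ← Finset.prod_univ_sum (fun _ => Finset.univ)
      (fun j (e : Fin M → ℤˣ) => (∏ i, signWeight (y j i) (e i)) * ((e (i j) : ℤ) : ℝ))]
    simp [sum_prod_signWeight_mul]
  have key : ∑ i, T i * ∏ j, y j (i j)
      = ∑ ε, w ε * ∑ i, T i * ∏ j, ((ε j (i j) : ℤ) : ℝ) := by
    simp_rw [hmean, Finset.mul_sum]
    rw [Finset.sum_comm]
    exact Finset.sum_congr rfl fun _ _ => Finset.sum_congr rfl fun _ _ => by ring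
  rw [key]
  calc _ ≤ ∑ ε, |w ε * ∑ i, T i * ∏ j, ((ε j (i j) : ℤ) : ℝ)| := Finset.abs_sum_le_sum_abs _ _
    _ ≤ ∑ ε, w ε * classicalValue T := by
        refine Finset.sum_le_sum fun ε _ => ?_
        rw [abs_mul, abs_of_nonneg (hw0 ε)]
        exact mul_le_mul_of_nonneg_left (le_classicalValue T ε) (hw0 ε)
    _ = classicalValue T := by rw [← Finset.sum_mul, hw1, one_mul]

theorem abs_le_classicalValue {N M : ℕ} (T : (Fin N → Fin M) → ℝ) (k : Fin N → Fin M) :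
    |T k| ≤ classicalValue T := by
  -- Indicator vectors lie in the cube and isolate a single coefficient.
  have h := abs_sum_le_classicalValue T (y := fun j i => if i = k j then 1 else 0)
    (fun j i => by split_ifs <;> simp)
  rwa [Finset.sum_eq_single k, Finset.prod_eq_one (by simp), mul_one] at h
  · intro i _ hi
    obtain ⟨j, hj⟩ := Function.ne_iff.1 hi
    rw [Finset.prod_eq_zero (Finset.mem_univ j) (by simp [hj]), mul_zero]
  · simp

/-- Writing each argument as real part plus `I` times imaginary part expands the form into `2 ^ N`
real ones, indexed by the set `s` of sites where the real part is taken. -/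
theorem norm_sum_le_classicalValue {N M : ℕ} (T : (Fin N → Fin M) → ℝ)
    {z : Fin N → Fin M → ℂ} (hz : ∀ j i, ‖z j i‖ ≤ 1) :
    ‖∑ i, (T i : ℂ) * ∏ j, z j (i j)‖ ≤ 2 ^ N * classicalValue T := by
  have h : ∑ i, (T i : ℂ) * ∏ j, z j (i j) = ∑ s : Finset (Fin N), Complex.I ^ (sᶜ).card *
      ((∑ i, T i * ∏ j, (if j ∈ s then (z j (i j)).re else (z j (i j)).im) : ℝ) : ℂ) := by
    have h1 : ∀ i : Fin N → Fin M, ∏ j, z j (i j) = ∑ s : Finset (Fin N),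
        Complex.I ^ (sᶜ).card *
          ∏ j, (((if j ∈ s then (z j (i j)).re else (z j (i j)).im) : ℝ) : ℂ) := by
      intro i
      have h2 : ∀ j, z j (i j) = ((z j (i j)).re : ℂ) + Complex.I * ((z j (i j)).im : ℂ) :=
        fun j => by rw [mul_comm, Complex.re_add_im]
      rw [Finset.prod_congr rfl fun j _ => h2 j, Finset.prod_add, Finset.powerset_univ]
      refine Finset.sum_congr rfl fun s _ => ?_
      rw [← Finset.compl_eq_univ_sdiff, Finset.prod_mul_distrib, Finset.prod_const,
        mul_left_comm, ← Finset.prod_mul_prod_compl s]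
      congr 2
      · exact Finset.prod_congr rfl fun j hj => by rw [if_pos hj]
      · exact Finset.prod_congr rfl fun j hj => by rw [if_neg (Finset.mem_compl.1 hj)]
    simp_rw [h1, Finset.mul_sum]
    rw [Finset.sum_comm]
    refine Finset.sum_congr rfl fun s _ => ?_
    push_cast
    rw [Finset.mul_sum]
    exact Finset.sum_congr rfl fun i _ => by ring
  rw [h]
  refine (norm_sum_le _ _).trans ((Finset.sum_le_sum (g := fun _ => classicalValue T)
    fun s _ => ?_).trans ?_)
  · rw [norm_mul, norm_pow, Complex.norm_I, one_pow, one_mul, Complex.norm_real, Real.norm_eq_abs]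
    refine abs_sum_le_classicalValue T
      (y := fun j i => if j ∈ s then (z j i).re else (z j i).im) fun j i => ?_
    split_ifs
    · exact (Complex.abs_re_le_norm _).trans (hz j i)
    · exact (Complex.abs_im_le_norm _).trans (hz j i)
  · simp

theorem norm_sum_le_pow_mul_classicalValue {N M : ℕ} (T : (Fin N → Fin M) → ℝ) {R : ℝ}
    (hR : 0 < R) {z : Fin N → Fin M → ℂ} (hz : ∀ j i, ‖z j i‖ ≤ R) :
    ‖∑ i, (T i : ℂ) * ∏ j, z j (i j)‖ ≤ (2 * R) ^ N * classicalValue T := by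
  have h : ∑ i, (T i : ℂ) * ∏ j, z j (i j)
      = (R : ℂ) ^ N * ∑ i, (T i : ℂ) * ∏ j, ((R : ℂ)⁻¹ * z j (i j)) := by
    rw [Finset.mul_sum]
    refine Finset.sum_congr rfl fun i _ => ?_
    rw [Finset.prod_mul_distrib, Finset.prod_const, Finset.card_univ, Fintype.card_fin,
      mul_left_comm, ← mul_assoc ((R : ℂ) ^ N), ← mul_pow,
      mul_inv_cancel₀ (Complex.ofReal_ne_zero.2 hR.ne'), one_pow, one_mul]
  rw [h, norm_mul, norm_pow, Complex.norm_real, Real.norm_of_nonneg hR.le, mul_pow,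
    mul_comm (2 ^ N), mul_assoc]
  gcongr
  refine norm_sum_le_classicalValue T (z := fun j i => (R : ℂ)⁻¹ * z j i) fun j i => ?_
  rw [norm_mul, norm_inv, Complex.norm_real, Real.norm_of_nonneg hR.le, inv_mul_le_one₀ hR]
  exact hz j i

theorem classicalValue_smul {N M : ℕ} (T : (Fin N → Fin M) → ℝ) {c : ℝ} (hc : 0 ≤ c) :
    classicalValue (fun i => c * T i) = c * classicalValue T := by
  rw [classicalValue, classicalValue, Real.mul_iSup_of_nonneg hc]
  refine iSup_congr fun ε => ?_
  rw [← abs_of_nonneg hc, ← abs_mul, Finset.mul_sum, abs_of_nonneg hc]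
  simp_rw [mul_assoc]

theorem quantumValue_smul {N M D : ℕ} (T : (Fin N → Fin M) → ℝ)
    (ρ : Matrix (Fin N → Fin D) (Fin N → Fin D) ℂ)
    (A : Fin N → Fin M → Matrix (Fin D) (Fin D) ℂ) {c : ℝ} (hc : 0 ≤ c) :
    quantumValue (fun i => c * T i) ρ A = c * quantumValue T ρ A := by
  rw [quantumValue, quantumValue, ← Real.norm_of_nonneg hc, ← Complex.norm_real, ← norm_mul,
    Finset.mul_sum, Complex.norm_real, Real.norm_of_nonneg hc]
  push_cast
  simp_rw [mul_assoc]

/-- Removes the normalization `classicalValue T = 1` by homogeneity; classical value `0` forces `T =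
0`, so nothing is lost there. -/
theorem quantumValue_le_of_largestViolation_le {N M D : ℕ} (T : (Fin N → Fin M) → ℝ)
    {ρ : Matrix (Fin N → Fin D) (Fin N → Fin D) ℂ} {K : ℝ≥0}
    (h : largestViolation ρ ≤ (K : ℝ≥0∞) ^ N) {A : Fin N → Fin M → Matrix (Fin D) (Fin D) ℂ}
    (hA : ∀ j m, IsDichotomic (A j m)) : quantumValue T ρ A ≤ K ^ N * classicalValue T := by
  rcases (classicalValue_nonneg T).eq_or_lt with h0 | h0
  · have hT : T = 0 := funext fun k => abs_nonpos_iff.1 (h0 ▸ abs_le_classicalValue T k)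
    rw [← h0, hT]
    simp [quantumValue]
  · have h1 : classicalValue (fun i => (classicalValue T)⁻¹ * T i) = 1 := by
      rw [classicalValue_smul T (by positivity), inv_mul_cancel₀ h0.ne']
    have h2 : ENNReal.ofReal (quantumValue (fun i => (classicalValue T)⁻¹ * T i) ρ A)
        ≤ (K : ℝ≥0∞) ^ N := by
      refine le_trans ?_ h
      exact le_iSup_of_le M (le_iSup_of_le _ (le_iSup_of_le h1 (le_iSup_of_le A
        (le_iSup_of_le hA le_rfl))))
    rw [quantumValue_smul T ρ A (by positivity), ← ENNReal.coe_pow,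
      ENNReal.ofReal_le_coe, NNReal.coe_pow, inv_mul_le_iff₀ h0] at h2
    · linarith

end Bell

/-! ### Homogeneous polynomials, tensors and polarization -/

/-- The `n`-linear form with coefficients `T` is bounded by `c` on the product of polydiscs. -/
def PolydiscBound {n M : ℕ} (T : (Fin n → Fin M) → ℂ) (c : ℝ) : Prop :=
  ∀ z : Fin n → Fin M → ℂ, (∀ j i, ‖z j i‖ ≤ 1) → ‖∑ i, T i * ∏ j, z j (i j)‖ ≤ c

namespace MvPolynomial

theorem IsHomogeneous.exists_eq_sum {M n : ℕ} {P : MvPolynomial (Fin M) ℂ}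
    (hP : P.IsHomogeneous n) : ∃ T : (Fin n → Fin M) → ℂ, P = ∑ i, T i • ∏ j, X (i j) := by
  have key : ∀ m : P.support, ∃ t : Fin n → Fin M, ∏ j, X (t j) = monomial m.1 (1 : ℂ) := by
    rintro ⟨m, hm⟩
    have hcard : (Finsupp.toMultiset m).toList.length = n := by
      rw [Multiset.length_toList, Finsupp.card_toMultiset]
      have := hP (mem_support_iff.1 hm)
      rw [Finsupp.weight_apply] at this
      simpa [Finsupp.sum] using this
    refine ⟨fun j => (Finsupp.toMultiset m).toList.get (j.cast hcard.symm), ?_⟩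
    subst hcard
    have h2 : (m.toMultiset.map (X (R := ℂ))).prod = monomial m (1 : ℂ) := by
      rw [Finsupp.toMultiset_map, Finsupp.prod_toMultiset, Finsupp.prod_mapDomain_index,
        monomial_eq, C_1, one_mul]
      · simp
      · intro _ _ _; rw [pow_add]
    rw [← h2]
    conv_rhs => rw [← Multiset.coe_toList m.toMultiset]
    rw [Multiset.map_coe, Multiset.prod_coe, ← List.ofFn_getElem (xs := List.map X _),
      List.prod_ofFn]
    simp only [List.get_eq_getElem, List.getElem_map]
    refine Fintype.prod_equiv (finCongr (by simp)) _ _ fun j => ?_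
    simp
  choose t ht using key
  -- The whole coefficient of a monomial `m` is placed on one chosen ordering `t m` of its
  -- variables, so this tensor need not be symmetric.
  refine ⟨fun i => ∑ m : P.support, if t m = i then P.coeff m else 0, ?_⟩
  simp_rw [Finset.sum_smul]
  rw [Finset.sum_comm]
  conv_lhs => rw [P.as_sum, ← Finset.sum_coe_sort]
  refine Finset.sum_congr rfl fun m _ => ?_
  rw [Finset.sum_eq_single (t m)]
  · rw [if_pos rfl, ht m, smul_monomial, smul_eq_mul, mul_one]
  · intro i _ hi
    rw [if_neg (Ne.symm hi), zero_smul]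
  · simp

/-- On the disc `w ↦ w z` the polynomial restricts to one variable, with the component of degree `n`
as its `n`-th coefficient; Parseval on the unit circle bounds that coefficient. -/
theorem norm_aeval_homogeneousComponent_le {M : ℕ} {P : MvPolynomial (Fin M) ℂ} {c : ℝ}
    (hP : ∀ z : Fin M → ℂ, (∀ i, ‖z i‖ ≤ 1) → ‖aeval z P‖ ≤ c) (n : ℕ) {z : Fin M → ℂ}
    (hz : ∀ i, ‖z i‖ ≤ 1) : ‖aeval z (homogeneousComponent n P)‖ ≤ c := by
  have hc : 0 ≤ c := (norm_nonneg _).trans (hP z hz)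
  rcases lt_or_ge P.totalDegree n with hn | hn
  · rw [homogeneousComponent_eq_zero _ _ hn, map_zero, norm_zero]
    exact hc
  have hscale : ∀ (k : ℕ) (w : ℂ), aeval (fun i => w * z i) (homogeneousComponent k P)
      = w ^ k * aeval z (homogeneousComponent k P) := by
    intro k w
    obtain ⟨T, hT⟩ := (homogeneousComponent_isHomogeneous k P).exists_eq_sum
    rw [hT]
    simp only [map_sum, map_smul, map_prod, aeval_X, smul_eq_mul, Finset.mul_sum,
      Finset.prod_mul_distrib, Finset.prod_const, Finset.card_univ, Fintype.card_fin]
    exact Finset.sum_congr rfl fun i _ => by ring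
  set q : Polynomial ℂ := ∑ k ∈ Finset.range (P.totalDegree + 1),
    Polynomial.monomial k (aeval z (homogeneousComponent k P)) with hq
  have hcoeff : q.coeff n = aeval z (homogeneousComponent n P) := by
    simp only [hq, Polynomial.finsetSum_coeff, Polynomial.coeff_monomial]
    rw [Finset.sum_ite_eq' _ n, if_pos (by simpa [Nat.lt_succ_iff] using hn)]
  have heval : ∀ w, q.eval w = aeval (fun i => w * z i) P := by
    intro w
    conv_rhs => rw [← sum_homogeneousComponent P]
    simp only [hq, Polynomial.eval_finsetSum, Polynomial.eval_monomial, map_sum, hscale]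
    exact Finset.sum_congr rfl fun k _ => mul_comm _ _
  rw [← hcoeff]
  refine le_of_sq_le_sq ?_ hc
  by_cases h0 : q.coeff n = 0
  · rw [h0]; simp; positivity
  refine (Finset.single_le_sum (f := fun i => ‖q.coeff i‖ ^ 2) (fun _ _ => by positivity)
    (Polynomial.mem_support_iff.2 h0)).trans ?_
  rw [q.sum_sq_norm_coeff_eq_circleAverage]
  refine Real.circleAverage_mono_on_of_le_circle ?_ fun w hw => ?_
  · exact ContinuousOn.circleIntegrable' (by fun_prop)
  · rw [heval]
    gcongr
    refine hP _ fun i => ?_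
    rw [norm_mul]
    have : ‖w‖ = 1 := by simpa using hw
    rw [this, one_mul]
    exact hz i

end MvPolynomial

theorem sum_signs_prod_mul_prod {n : ℕ} (f : Fin n → Fin n) :
    ∑ ε : Fin n → ℤˣ, (∏ k, ((ε k : ℤ) : ℂ)) * ∏ j, ((ε (f j) : ℤ) : ℂ)
      = if Function.Bijective f then 2 ^ n else 0 := by
  split_ifs with hf
  · have : ∀ ε : Fin n → ℤˣ,
        (∏ k, ((ε k : ℤ) : ℂ)) * ∏ j, ((ε (f j) : ℤ) : ℂ) = 1 := by
      intro ε
      rw [Function.Bijective.prod_comp hf (fun k => ((ε k : ℤ) : ℂ)), ← Finset.prod_mul_distrib]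
      refine Finset.prod_eq_one fun k _ => ?_
      rcases Int.units_eq_one_or (ε k) with h | h <;> simp [h]
    simp [this]
  · have hsurj : ¬ Function.Surjective f := fun h => hf (Finite.surjective_iff_bijective.1 h)
    obtain ⟨k, hk⟩ := not_forall.1 hsurj
    have hk' : ∀ j, f j ≠ k := fun j h => hk ⟨j, h⟩
    set S := ∑ ε : Fin n → ℤˣ, (∏ k, ((ε k : ℤ) : ℂ)) * ∏ j, ((ε (f j) : ℤ) : ℂ) with hS
    -- If `f` misses `k`, flipping the sign `ε k` negates the first product and leaves the second
    -- unchanged, so the sum is its own negative.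
    let g : Fin n → ℤˣ := fun i => if i = k then -1 else 1
    have h1 : S = -S := by
      conv_lhs => rw [hS]
      rw [← Equiv.sum_comp (Equiv.mulLeft g), hS, ← Finset.sum_neg_distrib]
      refine Finset.sum_congr rfl fun ε _ => ?_
      have h2 : ∏ i, (((g * ε) i : ℤˣ) : ℤ) = - ∏ i, ((ε i : ℤˣ) : ℤ) := by
        simp only [Pi.mul_apply, Units.val_mul, Finset.prod_mul_distrib, g]
        rw [Finset.prod_eq_single k (by intro b _ hb; simp [hb]) (by simp)]
        simp
      have h3 : ∏ j, (((g * ε) (f j) : ℤˣ) : ℤ) = ∏ j, ((ε (f j) : ℤˣ) : ℤ) :=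
        Finset.prod_congr rfl fun j _ => by simp [g, hk' j]
      simp only [Equiv.coe_mulLeft]
      have h2' := congrArg (Int.cast : ℤ → ℂ) h2
      have h3' := congrArg (Int.cast : ℤ → ℂ) h3
      push_cast at h2' h3'
      rw [h2', h3', neg_mul]
    exact self_eq_neg.1 h1

/-- The polarization formula for permanents. -/
theorem sum_signs_prod_sum {n : ℕ} (a : Fin n → Fin n → ℂ) :
    ∑ ε : Fin n → ℤˣ, (∏ k, ((ε k : ℤ) : ℂ)) * ∏ j, ∑ k, ((ε k : ℤ) : ℂ) * a k j
      = 2 ^ n * ∑ π : Equiv.Perm (Fin n), ∏ j, a (π j) j := by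
  have h : ∀ ε : Fin n → ℤˣ, (∏ k, ((ε k : ℤ) : ℂ)) * ∏ j, ∑ k, ((ε k : ℤ) : ℂ) * a k j
      = ∑ f : Fin n → Fin n, ((∏ k, ((ε k : ℤ) : ℂ)) * ∏ j, ((ε (f j) : ℤ) : ℂ)) *
          ∏ j, a (f j) j := by
    intro ε
    rw [Finset.prod_univ_sum, Fintype.piFinset_univ, Finset.mul_sum]
    refine Finset.sum_congr rfl fun f _ => ?_
    rw [Finset.prod_mul_distrib, mul_assoc]
  simp_rw [h]
  rw [Finset.sum_comm]
  simp_rw [← Finset.sum_mul, sum_signs_prod_mul_prod, ite_mul, zero_mul]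
  rw [← Finset.sum_filter, ← Finset.mul_sum]
  congr 1
  refine (Finset.sum_bij (fun (π : Equiv.Perm (Fin n)) _ => ⇑π) ?_ ?_ ?_ ?_).symm
  · exact fun π _ => Finset.mem_filter.2 ⟨Finset.mem_univ _, π.bijective⟩
  · intro π _ π' _ h; exact DFunLike.coe_injective h
  · intro f hf
    exact ⟨Equiv.ofBijective f (Finset.mem_filter.1 hf).2, Finset.mem_univ _, rfl⟩
  · intro π _; rfl

/-- The symmetrization of a tensor. -/
def symmetrize {n M : ℕ} (T : (Fin n → Fin M) → ℂ) (i : Fin n → Fin M) : ℂ :=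
  (n.factorial : ℂ)⁻¹ * ∑ π : Equiv.Perm (Fin n), T (i ∘ π)

theorem sum_symmetrize_smul {n M : ℕ} (T : (Fin n → Fin M) → ℂ) {R : Type*} [CommRing R]
    [Algebra ℂ R] (y : Fin n → Fin M → R) :
    ∑ i, symmetrize T i • ∏ j, y j (i j)
      = (n.factorial : ℂ)⁻¹ • ∑ i, T i • ∑ π : Equiv.Perm (Fin n), ∏ j, y (π j) (i j) := by
  simp only [symmetrize, mul_smul, Finset.sum_smul, Finset.smul_sum]
  rw [Finset.sum_comm, Finset.sum_comm (s := Finset.univ (α := Fin n → Fin M))]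
  refine Finset.sum_congr rfl fun π _ => ?_
  -- Reindexing the tensor positions by `π` moves the permutation from `T` to the arguments.
  rw [← Equiv.sum_comp (Equiv.arrowCongr π (Equiv.refl (Fin M)))]
  refine Finset.sum_congr rfl fun i _ => ?_
  congr 2
  · congr 1; ext j; simp
  · rw [← Equiv.prod_comp π]
    simp

theorem sum_symmetrize_smul_const {n M : ℕ} (T : (Fin n → Fin M) → ℂ) {R : Type*} [CommRing R]
    [Algebra ℂ R] (y : Fin M → R) :
    ∑ i, symmetrize T i • ∏ j, y (i j) = ∑ i, T i • ∏ j, y (i j) := by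
  rw [sum_symmetrize_smul T (fun _ => y)]
  simp only [Finset.sum_const, Finset.card_univ, Fintype.card_perm, Fintype.card_fin,
    Finset.smul_sum, ← Nat.cast_smul_eq_nsmul ℂ]
  refine Finset.sum_congr rfl fun i _ => ?_
  rw [smul_smul, smul_smul]
  congr 1
  have : (n.factorial : ℂ) ≠ 0 := Nat.cast_ne_zero.2 n.factorial_ne_zero
  field_simp

/-- By polarization the symmetrized form at `z` is the signed average over `ε`, divided by `n!`, of
the polynomial at `∑ ε_k z_k`. These points have coordinates of modulus at most `n`, so the bound is
`n ^ n / n! * c ≤ e ^ n * c`. -/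
theorem polydiscBound_symmetrize {n M : ℕ} {T : (Fin n → Fin M) → ℂ} {c : ℝ}
    (hT : ∀ z : Fin M → ℂ, (∀ i, ‖z i‖ ≤ 1) → ‖∑ i, T i * ∏ j, z (i j)‖ ≤ c) :
    PolydiscBound (symmetrize T) (Real.exp n * c) := by
  intro z hz
  have hc : 0 ≤ c := (norm_nonneg _).trans (hT 0 (by simp))
  have hn : ∀ w : Fin M → ℂ, (∀ i, ‖w i‖ ≤ n) → ‖∑ i, T i * ∏ j, w (i j)‖ ≤ n ^ n * c := by
    intro w hw
    rcases Nat.eq_zero_or_pos n with rfl | hpos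
    · simpa using hT 0 (by simp)
    have hn0 : (n : ℂ) ≠ 0 := Nat.cast_ne_zero.2 hpos.ne'
    have h1 : ∑ i, T i * ∏ j, w (i j)
        = (n : ℂ) ^ n * ∑ i, T i * ∏ j, ((n : ℂ)⁻¹ * w (i j)) := by
      rw [Finset.mul_sum]
      refine Finset.sum_congr rfl fun i _ => ?_
      rw [Finset.prod_mul_distrib, Finset.prod_const, Finset.card_univ, Fintype.card_fin,
        mul_left_comm, ← mul_assoc ((n : ℂ) ^ n), ← mul_pow, mul_inv_cancel₀ hn0, one_pow, one_mul]
    rw [h1, norm_mul, norm_pow, Complex.norm_natCast]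
    gcongr
    refine hT (fun i => (n : ℂ)⁻¹ * w i) fun i => ?_
    rw [norm_mul, norm_inv, Complex.norm_natCast, inv_mul_le_one₀ (by exact_mod_cast hpos)]
    exact hw i
  have h2 : (2 : ℂ) ^ n * ∑ i, T i * ∑ π : Equiv.Perm (Fin n), ∏ j, z (π j) (i j)
      = ∑ ε : Fin n → ℤˣ, (∏ k, ((ε k : ℤ) : ℂ)) *
          ∑ i, T i * ∏ j, ∑ k, ((ε k : ℤ) : ℂ) * z k (i j) := by
    simp_rw [Finset.mul_sum (s := (Finset.univ : Finset (Fin n → Fin M)))]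
    rw [Finset.sum_comm]
    refine Finset.sum_congr rfl fun i _ => ?_
    rw [mul_left_comm, ← sum_signs_prod_sum (fun k j => z k (i j)), Finset.mul_sum]
    exact Finset.sum_congr rfl fun ε _ => by ring
  have h3 : ‖∑ i, T i * ∑ π : Equiv.Perm (Fin n), ∏ j, z (π j) (i j)‖ ≤ n ^ n * c := by
    have h4 : ‖(2 : ℂ) ^ n * ∑ i, T i * ∑ π : Equiv.Perm (Fin n), ∏ j, z (π j) (i j)‖
        ≤ 2 ^ n * (n ^ n * c) := by
      rw [h2]
      refine (norm_sum_le _ _).trans ((Finset.sum_le_sum (g := fun _ => (n : ℝ) ^ n * c)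
        fun ε _ => ?_).trans ?_)
      · have hε : ∀ k, ‖((ε k : ℤ) : ℂ)‖ = 1 := fun k => by
          rcases Int.units_eq_one_or (ε k) with h | h <;> simp [h]
        rw [norm_mul, norm_prod, Finset.prod_eq_one (fun k _ => hε k), one_mul]
        refine hn (fun m => ∑ k, ((ε k : ℤ) : ℂ) * z k m) fun m => ?_
        refine (norm_sum_le _ _).trans ((Finset.sum_le_sum (g := fun _ => (1 : ℝ))
          fun k _ => ?_).trans ?_)
        · rw [norm_mul, hε, one_mul]
          exact hz k m
        · simp
      · simp
    rw [norm_mul, norm_pow, Complex.norm_ofNat] at h4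
    exact le_of_mul_le_mul_left h4 (by positivity)
  have h5 := sum_symmetrize_smul T z
  simp only [smul_eq_mul] at h5
  rw [h5, norm_mul, norm_inv, Complex.norm_natCast]
  calc _ ≤ (n.factorial : ℝ)⁻¹ * (n ^ n * c) := by gcongr
    _ = (n : ℝ) ^ n / n.factorial * c := by ring
    _ ≤ Real.exp n * c := by
        gcongr
        exact Real.pow_div_factorial_le_exp _ (by positivity) n

/-! ### A criterion for Q-algebras -/

open MvPolynomial in
theorem MvPolynomial.aeval_smul_sum_prod_X {n M : ℕ} (T : (Fin n → Fin M) → ℂ) {R : Type*}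
    [CommRing R] [Algebra ℂ R] (c : ℂ) (y : Fin M → R) :
    aeval (fun i => c • y i) (∑ i, T i • ∏ j, X (i j) : MvPolynomial (Fin M) ℂ)
      = c ^ n • ∑ i, T i • ∏ j, y (i j) := by
  simp only [map_sum, map_smul, map_prod, aeval_X, Finset.smul_sum]
  refine Finset.sum_congr rfl fun i _ => ?_
  simp only [Algebra.smul_def, Finset.prod_mul_distrib, Finset.prod_const, Finset.card_univ,
    Fintype.card_fin, map_pow]
  exact mul_left_comm _ _ _

section Criterion

universe u

variable {X : Type u} [NonUnitalNormedCommRing X] [NormedSpace ℂ X]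
  [IsScalarTower ℂ X X] [SMulCommClass ℂ X X]

variable (X) in
/-- Davie's condition: multilinear forms bounded on polydiscs act on `X` with a geometric bound.
Products are computed in the unitization, since `X` need not have a unit. -/
def DavieCondition (C : ℝ) : Prop :=
  ∀ (n M : ℕ) (T : (Fin n → Fin M) → ℂ) (x : Fin n → Fin M → X), 1 ≤ n →
    (∀ j i, ‖x j i‖ ≤ 1) → PolydiscBound T 1 →
      ‖(∑ i, T i • ∏ j, (x j (i j) : Unitization ℂ X)).snd‖ ≤ C ^ n

/-- Here the hypothesis on `T` only concerns equal arguments. Symmetrizing leaves the value at equal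
arguments unchanged and makes Davie's condition applicable, at the price of `e ^ n`. -/
theorem DavieCondition.norm_snd_sum_le {C : ℝ} (hC : DavieCondition X C) {n M : ℕ}
    {T : (Fin n → Fin M) → ℂ} {x : Fin M → X} {c : ℝ} (hc : 0 < c) (hn : 1 ≤ n)
    (hx : ∀ i, ‖x i‖ ≤ 1)
    (hT : ∀ z : Fin M → ℂ, (∀ i, ‖z i‖ ≤ 1) → ‖∑ i, T i * ∏ j, z (i j)‖ ≤ c) :
    ‖(∑ i, T i • ∏ j, (x (i j) : Unitization ℂ X)).snd‖ ≤ (C * Real.exp 1) ^ n * c := by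
  set E := Real.exp n * c with hE
  have hE0 : 0 < E := by positivity
  have hEC : (E : ℂ) ≠ 0 := Complex.ofReal_ne_zero.2 hE0.ne'
  have h1 := hC n M (fun i => (E : ℂ)⁻¹ * symmetrize T i) (fun _ => x) hn (fun _ i => hx i) (by
    intro z hz
    have := polydiscBound_symmetrize hT z hz
    simp_rw [mul_assoc, ← Finset.mul_sum]
    rw [norm_mul, norm_inv, Complex.norm_real, Real.norm_of_nonneg hE0.le, inv_mul_le_one₀ hE0]
    exact this)
  simp_rw [mul_smul, ← Finset.smul_sum] at h1
  rw [sum_symmetrize_smul_const T (fun i => (x i : Unitization ℂ X)), Unitization.snd_smul,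
    norm_smul, norm_inv, Complex.norm_real, Real.norm_of_nonneg hE0.le, inv_mul_le_iff₀ hE0] at h1
  refine h1.trans_eq ?_
  rw [hE, mul_pow, ← Real.exp_nat_mul, mul_one]
  ring

open MvPolynomial in
-- The scaling `δ = 1 / (2 C e)` turns the bound `(C e) ^ n c` for degree `n` into `2 ^ (-n) c`, and
-- these sum over `n ≥ 1` to at most `c`.
theorem DavieCondition.norm_snd_aeval_le {C : ℝ} (hC : DavieCondition X C) (hC0 : 0 < C)
    {M : ℕ} {P : MvPolynomial (Fin M) ℂ} {x : Fin M → X} {c : ℝ} (hc : 0 < c)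
    (hx : ∀ i, ‖x i‖ ≤ 1) (hP : ∀ z : Fin M → ℂ, (∀ i, ‖z i‖ ≤ 1) → ‖aeval z P‖ ≤ c) :
    ‖(aeval (fun i => ((((2 * C * Real.exp 1)⁻¹ : ℝ) : ℂ) • x i : Unitization ℂ X)) P).snd‖
      ≤ c := by
  set δ : ℝ := (2 * C * Real.exp 1)⁻¹ with hδ
  have hδ0 : 0 < δ := by positivity
  have hterm : ∀ n, 1 ≤ n →
      ‖(aeval (fun i => ((δ : ℂ) • x i : Unitization ℂ X)) (homogeneousComponent n P)).snd‖
        ≤ (1 / 2) ^ n * c := by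
    intro n hn
    obtain ⟨T, hT⟩ := (homogeneousComponent_isHomogeneous n P).exists_eq_sum
    have h1 : ∀ z : Fin M → ℂ, (∀ i, ‖z i‖ ≤ 1) → ‖∑ i, T i * ∏ j, z (i j)‖ ≤ c := by
      intro z hz
      have := norm_aeval_homogeneousComponent_le hP n hz
      rw [hT] at this
      simpa only [map_sum, map_smul, map_prod, aeval_X, smul_eq_mul] using this
    have h2 := hC.norm_snd_sum_le hc hn hx h1
    have h3 : aeval (fun i => ((δ : ℂ) • x i : Unitization ℂ X)) (homogeneousComponent n P)
        = (δ : ℂ) ^ n • ∑ i, T i • ∏ j, (x (i j) : Unitization ℂ X) := by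
      rw [hT]
      exact aeval_smul_sum_prod_X T (δ : ℂ) fun i => (x i : Unitization ℂ X)
    rw [h3, Unitization.snd_smul, norm_smul, norm_pow, Complex.norm_real,
      Real.norm_of_nonneg hδ0.le]
    refine (mul_le_mul_of_nonneg_left h2 (by positivity)).trans_eq ?_
    rw [← mul_assoc, ← mul_pow, hδ]
    congr 2
    field_simp
  -- The constant term lives in the scalar part of the unitization, so the geometric sum starts at
  -- degree one.
  have h0 : (aeval (fun i => ((δ : ℂ) • x i : Unitization ℂ X)) (homogeneousComponent 0 P)).snd
      = 0 := by
    rw [homogeneousComponent_zero, aeval_C, Unitization.algebraMap_eq_inl]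
    exact Unitization.snd_inl _ _
  conv_lhs => rw [← sum_homogeneousComponent P]
  rw [map_sum, Finset.sum_range_succ', Unitization.snd_add, h0, add_zero]
  have hsnd : ∀ (m : ℕ) (f : ℕ → Unitization ℂ X),
      (∑ k ∈ Finset.range m, f k).snd = ∑ k ∈ Finset.range m, (f k).snd :=
    fun m f => map_sum (Unitization.sndHom (R := ℂ) (A := X) ℂ) f _
  rw [hsnd]
  refine (norm_sum_le _ _).trans ((Finset.sum_le_sum fun k _ => hterm (k + 1) (by lia)).trans ?_)
  rw [← Finset.sum_mul]
  refine mul_le_of_le_one_left hc.le ?_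
  have h := sum_geometric_two_le P.totalDegree
  simp_rw [pow_succ, ← Finset.sum_mul]
  linarith

open MvPolynomial in
theorem DavieCondition.norm_snd_aeval_le' {C : ℝ} (hC : DavieCondition X C) (hC0 : 0 < C)
    {σ : Type*} {P : MvPolynomial σ ℂ} {x : σ → X} {c : ℝ} (hc : 0 < c)
    (hx : ∀ i, ‖x i‖ ≤ 1) (hP : ∀ z : σ → ℂ, (∀ i, ‖z i‖ ≤ 1) → ‖aeval z P‖ ≤ c) :
    ‖(aeval (fun i => ((((2 * C * Real.exp 1)⁻¹ : ℝ) : ℂ) • x i : Unitization ℂ X)) P).snd‖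
      ≤ c := by
  obtain ⟨M, f, hf, q, rfl⟩ := exists_fin_rename P
  rw [aeval_rename]
  refine hC.norm_snd_aeval_le hC0 (x := x ∘ f) hc (fun i => hx _) fun z hz => ?_
  -- Variables that do not occur in the polynomial are set to `0`, which stays in the polydisc.
  have h := hP (Function.extend f z 0) fun i => ?_
  · rwa [aeval_rename, Function.extend_comp hf] at h
  · by_cases hi : ∃ j, f j = i
    · obtain ⟨j, rfl⟩ := hi
      rw [hf.extend_apply]
      exact hz j
    · rw [Function.extend_apply' _ _ _ hi]
      simp

theorem IsQAlgebra.of_surjective [CompleteSpace X] {K : Type u} [TopologicalSpace K]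
    [CompactSpace K] [T2Space K] (A : NonUnitalSubalgebra ℂ C(K, ℂ))
    (hA : IsClosed (A : Set C(K, ℂ))) (π : A →L[ℂ] X) (hπ : Function.Surjective π)
    (hmul : ∀ a b, π (a * b) = π a * π b) : IsQAlgebra X := by
  refine ⟨K, inferInstance, inferInstance, inferInstance, A, π.ker, hA,
    π.isClosed_ker, fun a b hb => ?_, ?_⟩
  · rw [LinearMap.mem_ker] at hb ⊢
    exact (hmul a b).trans (by rw [show π b = 0 from hb, mul_zero])
  · have : CompleteSpace A := hA.completeSpace_coe
    -- The open mapping theorem makes the inverse of the induced bijection continuous.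
    have hopen : IsOpenMap π := by
      let : NormedAddCommGroup A := inferInstanceAs (NormedAddCommGroup A.toSubmodule)
      let : NormedSpace ℂ A := inferInstanceAs (NormedSpace ℂ A.toSubmodule)
      exact π.isOpenMap hπ
    let e : (A ⧸ π.ker) ≃ₗ[ℂ] X := (π : A →ₗ[ℂ] X).quotKerEquivOfSurjective hπ
    have he : ∀ a : A, e (Submodule.Quotient.mk a) = π a := fun a => rfl
    have hcont : Continuous e := by
      refine (π.ker.isQuotientMap_mkQ).continuous_iff.2 ?_
      exact π.continuous
    have hsymm : Continuous e.symm := by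
      refine (hopen.isQuotientMap π.continuous hπ).continuous_iff.2 ?_
      have : e.symm ∘ π = fun a : A => π.ker.mkQ a := by
        funext a
        exact (LinearEquiv.symm_apply_eq e).2 (he a).symm
      rw [this]
      exact π.ker.isQuotientMap_mkQ.continuous
    refine ⟨⟨e, hcont, hsymm⟩, fun a b => ?_⟩
    exact hmul a b

/-- A closed graph over a closed subalgebra: if the elements `p` of a closed subalgebra of a product
satisfy `‖p.2‖ ≤ ‖p.1‖`, the subalgebra is the graph of a contractive homomorphism. -/
theorem IsQAlgebra.of_graph [CompleteSpace X] {K : Type u} [TopologicalSpace K]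
    [CompactSpace K] [T2Space K] (G : NonUnitalSubalgebra ℂ (C(K, ℂ) × X))
    (hG : IsClosed (G : Set (C(K, ℂ) × X))) (hle : ∀ p ∈ G, ‖p.2‖ ≤ ‖p.1‖)
    (hsurj : ∀ x, ∃ f, (f, x) ∈ G) : IsQAlgebra X := by
  let A : NonUnitalSubalgebra ℂ C(K, ℂ) := G.map (NonUnitalAlgHom.fst ℂ C(K, ℂ) X)
  have hA : IsClosed (A : Set C(K, ℂ)) := by
    have : CompleteSpace G.toSubmodule := hG.completeSpace_coe
    let f : G.toSubmodule →ₗ[ℂ] C(K, ℂ) := (LinearMap.fst ℂ C(K, ℂ) X) ∘ₗ G.toSubmodule.subtype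
    -- In the max norm the hypothesis `hle` makes the first projection isometric on `G`; since `G`
    -- is complete, its image is closed.
    have hf : Isometry f := by
      refine AddMonoidHomClass.isometry_of_norm f fun g => ?_
      exact (max_eq_left (hle g.1 g.2)).symm
    have hr : (A : Set C(K, ℂ)) = Set.range f := by
      ext a
      constructor
      · rintro ⟨p, hp, rfl⟩
        exact ⟨⟨p, hp⟩, rfl⟩
      · rintro ⟨⟨p, hp⟩, rfl⟩
        exact ⟨p, hp, rfl⟩
    rw [hr]
    exact hf.isClosedEmbedding.isClosed_range
  have hex : ∀ a : A, ∃ x, ((a : C(K, ℂ)), x) ∈ G := by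
    rintro ⟨_, ⟨⟨f, x⟩, hp, rfl⟩⟩
    exact ⟨x, hp⟩
  choose g hg using hex
  have huniq : ∀ (f : C(K, ℂ)) (x y : X), (f, x) ∈ G → (f, y) ∈ G → x = y := by
    intro f x y hx hy
    have h := hle _ (sub_mem hx hy)
    rw [Prod.mk_sub_mk, sub_self, norm_zero] at h
    exact sub_eq_zero.1 (norm_le_zero_iff.1 h)
  let L : A →ₗ[ℂ] X :=
    { toFun := g
      map_add' := fun a b => huniq _ _ _ (hg (a + b)) (add_mem (hg a) (hg b))
      map_smul' := fun c a => huniq _ _ _ (hg (c • a)) (SMulMemClass.smul_mem c (hg a)) }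
  have hL : Continuous L := by
    let : NormedAddCommGroup A := inferInstanceAs (NormedAddCommGroup A.toSubmodule)
    exact AddMonoidHomClass.continuous_of_bound L 1 fun a => by
      rw [one_mul]
      exact hle _ (hg a)
  refine IsQAlgebra.of_surjective A hA ⟨L, hL⟩ (fun x => ?_) fun a b => ?_
  · obtain ⟨f, hf⟩ := hsurj x
    exact ⟨⟨f, ⟨(f, x), hf, rfl⟩⟩, huniq f _ _ (hg ⟨f, _⟩) hf⟩
  · exact huniq _ _ _ (hg (a * b)) (mul_mem (hg a) (hg b))

open MvPolynomial in
theorem DavieCondition.isQAlgebra [CompleteSpace X] {C : ℝ} (hC : DavieCondition X C)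
    (hC0 : 0 < C) : IsQAlgebra X := by
  -- One disc variable for each element of the unit ball of `X`. `G₀` relates a polynomial as a
  -- function on the polydisc to its value at the points `δ s`; requiring this value to lie in `X`
  -- excludes constant terms.
  let σ := Metric.closedBall (0 : X) 1
  let Ω := σ → Metric.closedBall (0 : ℂ) 1
  let z : σ → C(Ω, ℂ) := fun s => ⟨fun ω => (ω s : ℂ), by fun_prop⟩
  set δ : ℝ := (2 * C * Real.exp 1)⁻¹ with hδ
  have hδ0 : 0 < δ := by positivity
  let y : σ → Unitization ℂ X := fun s => (δ : ℂ) • (s.1 : Unitization ℂ X)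
  let G₀ : NonUnitalSubalgebra ℂ (C(Ω, ℂ) × X) :=
    { carrier := {p | ∃ P : MvPolynomial σ ℂ, aeval z P = p.1 ∧ aeval y P = (p.2 : Unitization ℂ X)}
      add_mem' := by
        rintro p q ⟨P, hP1, hP2⟩ ⟨Q, hQ1, hQ2⟩
        exact ⟨P + Q, by rw [map_add, hP1, hQ1]; rfl, by
          rw [map_add, hP2, hQ2, Prod.snd_add, Unitization.inr_add]⟩
      zero_mem' := ⟨0, by rw [map_zero]; rfl, by
        rw [map_zero, Prod.snd_zero, Unitization.inr_zero]⟩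
      mul_mem' := by
        rintro p q ⟨P, hP1, hP2⟩ ⟨Q, hQ1, hQ2⟩
        exact ⟨P * Q, by rw [map_mul, hP1, hQ1]; rfl, by
          rw [map_mul, hP2, hQ2, Prod.snd_mul, Unitization.inr_mul]⟩
      smul_mem' := by
        rintro c p ⟨P, hP1, hP2⟩
        exact ⟨c • P, by rw [map_smul, hP1]; rfl, by
          rw [map_smul, hP2, Prod.smul_snd, Unitization.inr_smul]⟩ }
  have hle₀ : ∀ p ∈ G₀, ‖p.2‖ ≤ ‖p.1‖ := by
    rintro ⟨f, x⟩ ⟨P, hP1, hP2⟩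
    -- The polynomial estimate needs a strictly positive bound, so it is applied to every `c > ‖f‖`.
    refine le_of_forall_gt_imp_ge_of_dense fun c hc => ?_
    have h := hC.norm_snd_aeval_le' hC0 (P := P) (x := fun s : σ => s.1)
      ((norm_nonneg _).trans_lt hc) (fun s => mem_closedBall_zero_iff.1 s.2) fun w hw => ?_
    · have h2 : ‖(aeval y P).snd‖ ≤ c := h
      rw [hP2] at h2
      exact h2
    · let ω : Ω := fun s => ⟨w s, by simpa using hw s⟩
      have h3 : aeval w P = aeval z P ω := by
        have := congrArg (fun φ => φ P) (algHom_ext (f := aeval w)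
          (g := (ContinuousMap.evalAlgHom ℂ ℂ ω).comp (aeval z)) fun s => by simp [z, ω])
        exact this
      rw [h3, hP1]
      exact (f.norm_coe_le_norm ω).trans hc.le
  refine IsQAlgebra.of_graph G₀.topologicalClosure G₀.isClosed_topologicalClosure ?_ fun x => ?_
  · intro p hp
    refine closure_minimal (s := (G₀ : Set (C(Ω, ℂ) × X))) (t := {p | ‖p.2‖ ≤ ‖p.1‖}) hle₀
      (isClosed_le (by fun_prop) (by fun_prop)) hp
  · have hmem : ∀ s : σ, (z s, (δ : ℂ) • s.1) ∈ G₀.topologicalClosure := fun s =>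
      G₀.le_topologicalClosure ⟨MvPolynomial.X s, by simp, by simp [y]⟩
    by_cases hx : x = 0
    · exact ⟨0, by rw [hx]; exact zero_mem _⟩
    have hx0 : ‖x‖ ≠ 0 := norm_ne_zero_iff.2 hx
    have hs : ((‖x‖⁻¹ : ℝ) : ℂ) • x ∈ σ := mem_closedBall_zero_iff.2 (by simp [norm_smul, hx0])
    -- The coordinate function of `x / ‖x‖` is sent to `δ x / ‖x‖`; the factor `‖x‖ / δ` restores
    -- `x`.
    have h := SMulMemClass.smul_mem ((‖x‖ / δ : ℝ) : ℂ) (hmem ⟨_, hs⟩)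
    refine ⟨((‖x‖ / δ : ℝ) : ℂ) • z ⟨_, hs⟩, ?_⟩
    convert h using 1
    rw [Prod.smul_mk, smul_smul, smul_smul, ← Complex.ofReal_mul, ← Complex.ofReal_mul]
    congr 1
    rw [show ‖x‖ / δ * δ * ‖x‖⁻¹ = 1 by field_simp, Complex.ofReal_one, one_smul]

end Criterion

/-! ### Diagonal states and finite sections of operators on `ℓ²(ℕ)` -/

namespace Ell2

theorem e_apply (i j : ℕ) : e i j = if j = i then 1 else 0 := by
  rw [e, lp.single_apply, Pi.single_apply]

theorem orthonormal_e : Orthonormal ℂ e := by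
  rw [orthonormal_iff_ite]
  intro i j
  rw [show ⟪e i, e j⟫_ℂ = coord i (e j) from rfl, coord_apply, e_apply]

/-- The inclusion of `ℂ^D` as the span of the first `D` basis vectors. -/
def incl (D : ℕ) : EuclideanSpace ℂ (Fin D) →ₗᵢ[ℂ] Ell2 where
  toFun u := ∑ i, u i • e i
  map_add' u v := by simp [add_smul, Finset.sum_add_distrib]
  map_smul' c u := by simp [mul_smul, Finset.smul_sum]
  norm_map' u := by
    have h := (orthonormal_e.comp (fun i : Fin D => (i : ℕ)) Fin.val_injective).inner_sum u u
      Finset.univ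
    have h2 : ‖∑ i : Fin D, u i • e i‖ ^ 2 = ‖u‖ ^ 2 := by
      rw [← Complex.ofReal_inj, EuclideanSpace.norm_sq_eq]
      push_cast
      refine (inner_self_eq_norm_sq_to_K (𝕜 := ℂ) _).symm.trans (h.trans ?_)
      exact Finset.sum_congr rfl fun i _ => Complex.conj_mul' _
    exact (sq_eq_sq₀ (norm_nonneg _) (norm_nonneg _)).1 h2

theorem incl_apply {D : ℕ} (u : EuclideanSpace ℂ (Fin D)) : incl D u = ∑ i, u i • e i := rfl

theorem incl_single {D : ℕ} (i : Fin D) : incl D (EuclideanSpace.single i 1) = e i := by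
  rw [incl_apply, Finset.sum_eq_single i]
  · simp
  · intro j _ hj
    simp [hj]
  · simp

theorem incl_coord {D : ℕ} (u : EuclideanSpace ℂ (Fin D)) (i : Fin D) :
    incl D u i = u i := by
  rw [← coord_apply, incl_apply, map_sum, Finset.sum_eq_single i]
  · simp [coord_apply, e_apply]
  · intro j _ hj
    simp [coord_apply, e_apply, Fin.val_inj, hj.symm]
  · simp

theorem inner_incl {D : ℕ} (B : Ell2 →L[ℂ] Ell2) (u v : EuclideanSpace ℂ (Fin D)) :
    ⟪incl D u, B (incl D v)⟫_ℂ = ∑ s, ∑ t, star (u s) * v t * entry B s t := by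
  rw [incl_apply u, sum_inner]
  refine Finset.sum_congr rfl fun s _ => ?_
  rw [inner_smul_left, show ⟪e s, B (incl D v)⟫_ℂ = coord s (B (incl D v)) from rfl, incl_apply,
    map_sum, map_sum, Finset.mul_sum]
  refine Finset.sum_congr rfl fun t _ => ?_
  rw [map_smul, map_smul, coord_apply, smul_eq_mul, entry]
  simp only [RCLike.star_def]
  ring

/-- The upper left corner of a matrix. -/
def corner (D : ℕ) (B : Ell2 →L[ℂ] Ell2) : Matrix (Fin D) (Fin D) ℂ :=
  Matrix.of fun s t => entry B s t

theorem corner_mulVec {D : ℕ} (B : Ell2 →L[ℂ] Ell2) (v : EuclideanSpace ℂ (Fin D)) (s : Fin D) :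
    Matrix.toEuclideanCLM (𝕜 := ℂ) (corner D B) v s = B (incl D v) s := by
  rw [Matrix.ofLp_toEuclideanCLM, Matrix.mulVec, dotProduct, incl_apply, map_sum, ← coord_apply,
    map_sum]
  refine Finset.sum_congr rfl fun t _ => ?_
  rw [map_smul, map_smul, coord_apply, smul_eq_mul, mul_comm]
  rfl

/-- The corner is a compression: its output is the first `D` coordinates of `B (incl D v)`. -/
theorem norm_corner_apply_le {D : ℕ} (B : Ell2 →L[ℂ] Ell2) (v : EuclideanSpace ℂ (Fin D)) :
    ‖Matrix.toEuclideanCLM (𝕜 := ℂ) (corner D B) v‖ ≤ ‖B‖ * ‖v‖ := by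
  have h1 : ‖Matrix.toEuclideanCLM (𝕜 := ℂ) (corner D B) v‖ ≤ ‖B (incl D v)‖ := by
    refine le_of_sq_le_sq ?_ (norm_nonneg _)
    rw [EuclideanSpace.norm_sq_eq]
    simp_rw [corner_mulVec]
    rw [Fin.sum_univ_eq_sum_range (fun i => ‖B (incl D v) i‖ ^ 2)]
    exact sum_sq_le _ _
  refine h1.trans ((B.le_opNorm _).trans_eq ?_)
  rw [LinearIsometry.norm_map]

end Ell2

namespace SInfty

/-- A matrix, as an operator on the span of the first `D` basis vectors of `ℓ²(ℕ)`. -/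
def ofMatrix {D : ℕ} (A : Matrix (Fin D) (Fin D) ℂ) : SInfty :=
  ⟨((Ell2.incl D).toContinuousLinearMap ∘L Matrix.toEuclideanCLM (𝕜 := ℂ) A) ∘L
      ContinuousLinearMap.adjoint (Ell2.incl D).toContinuousLinearMap,
    (isCompactOperator_of_locallyCompactSpace_dom
      (ContinuousLinearMap.adjoint (Ell2.incl D).toContinuousLinearMap)).clm_comp
      ((Ell2.incl D).toContinuousLinearMap ∘L Matrix.toEuclideanCLM (𝕜 := ℂ) A)⟩

theorem entry_ofMatrix {D : ℕ} (A : Matrix (Fin D) (Fin D) ℂ) (s t : Fin D) :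
    Ell2.entry (ofMatrix A).toCLM s t = A s t := by
  have h : ContinuousLinearMap.adjoint (Ell2.incl D).toContinuousLinearMap (Ell2.e t)
      = EuclideanSpace.single t 1 := by
    rw [← Ell2.incl_single]
    refine ext_inner_left ℂ fun v => ?_
    rw [ContinuousLinearMap.adjoint_inner_right]
    exact (Ell2.incl D).inner_map_map _ _
  change Ell2.incl D (Matrix.toEuclideanCLM (𝕜 := ℂ) A
    (ContinuousLinearMap.adjoint (Ell2.incl D).toContinuousLinearMap (Ell2.e t))) s = _
  rw [h, Ell2.incl_coord, Matrix.ofLp_toEuclideanCLM]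
  simp

theorem norm_ofMatrix_le {D : ℕ} {A : Matrix (Fin D) (Fin D) ℂ}
    (hA : ∀ v, ‖Matrix.toEuclideanCLM (𝕜 := ℂ) A v‖ ≤ ‖v‖) : ‖ofMatrix A‖ ≤ 1 := by
  rw [norm_def]
  refine ContinuousLinearMap.opNorm_le_bound _ zero_le_one fun x => ?_
  change ‖Ell2.incl D (Matrix.toEuclideanCLM (𝕜 := ℂ) A
    (ContinuousLinearMap.adjoint (Ell2.incl D).toContinuousLinearMap x))‖ ≤ _
  rw [LinearIsometry.norm_map]
  refine (hA _).trans ((ContinuousLinearMap.le_opNorm _ _).trans ?_)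
  gcongr
  rw [LinearIsometryEquiv.norm_map]
  exact (Ell2.incl D).norm_toContinuousLinearMap_le

end SInfty

theorem ContinuousLinearMap.norm_apply_le_of_isPositive {E : Type*}
    [NormedAddCommGroup E] [InnerProductSpace ℂ E] {T : E →L[ℂ] E} (h1 : (1 - T).IsPositive)
    (h2 : (1 + T).IsPositive) (v : E) : ‖T v‖ ≤ ‖v‖ := by
  have hsymm : ∀ x y, ⟪T x, y⟫_ℂ = ⟪x, T y⟫_ℂ := by
    intro x y
    have := h1.1 x y
    simpa [inner_sub_left, inner_sub_right] using this
  -- Adding the two positivity statements, at `v + T v` for `1 - T` and at `v - T v` for `1 + T`,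
  -- leaves `2 (‖v‖² - ‖T v‖²) ≥ 0`.
  have a := h1.2 (v + T v)
  have b := h2.2 (v - T v)
  simp only [ContinuousLinearMap.reApplyInnerSelf_apply, sub_apply,
    add_apply, one_apply_eq_self, map_add, map_sub,
    inner_add_left, inner_sub_left, inner_add_right, inner_sub_right] at a b
  have c : (⟪T (T v), v⟫_ℂ).re = ‖T v‖ ^ 2 := by
    rw [hsymm]
    exact inner_self_eq_norm_sq (𝕜 := ℂ) _
  have d : (⟪v, v⟫_ℂ).re = ‖v‖ ^ 2 := inner_self_eq_norm_sq (𝕜 := ℂ) _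
  simp only [RCLike.re_to_complex] at a b
  refine le_of_sq_le_sq ?_ (norm_nonneg _)
  linarith

namespace Bell

theorem trace_pureState_diagonalVector {N D : ℕ} (α : Fin D → ℂ)
    (B : Matrix (Fin N → Fin D) (Fin N → Fin D) ℂ) :
    Matrix.trace (pureState (diagonalVector N α) * B)
      = ∑ s, ∑ t, star (α s) * α t * B (fun _ => s) (fun _ => t) := by
  have hψ : ∀ f : (Fin N → Fin D) → ℂ,
      ∑ s, diagonalVector N α s * f s = ∑ i, α i * f fun _ => i := by
    intro f
    have h : ∀ s, diagonalVector N α s = ∑ i, α i * if s = (fun _ => i) then 1 else 0 := by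
      intro s
      simp [diagonalVector, Pi.single_apply]
    simp_rw [h, Finset.sum_mul]
    rw [Finset.sum_comm]
    refine Finset.sum_congr rfl fun i _ => ?_
    rw [Finset.sum_eq_single (fun _ => i)]
    · simp
    · intro s _ hs
      simp [hs]
    · simp
  have hψ' : ∀ f : (Fin N → Fin D) → ℂ,
      ∑ s, star (diagonalVector N α s) * f s = ∑ i, star (α i) * f fun _ => i := by
    intro f
    have h := congrArg star (hψ fun s => star (f s))
    simpa [mul_comm] using h
  simp only [Matrix.trace, Matrix.diag_apply, Matrix.mul_apply, pureState, Matrix.of_apply]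
  rw [Finset.sum_comm]
  simp_rw [mul_comm (diagonalVector N α _), mul_assoc, ← Finset.mul_sum, hψ, hψ']

/-- At constant multi-indices an entry of a tensor product is a product of entries, which is how the
Schur product enters. -/
theorem quantumValue_diagonalVector {N M D : ℕ} (T : (Fin N → Fin M) → ℝ) (α : Fin D → ℂ)
    (A : Fin N → Fin M → Matrix (Fin D) (Fin D) ℂ) :
    quantumValue T (pureState (diagonalVector N α)) A
      = ‖∑ s, ∑ t, star (α s) * α t * ∑ i, (T i : ℂ) * ∏ j, A j (i j) s t‖ := by
  rw [quantumValue]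
  congr 1
  simp_rw [trace_pureState_diagonalVector, tensor, Matrix.of_apply, Finset.mul_sum]
  rw [Finset.sum_comm]
  refine Finset.sum_congr rfl fun s _ => ?_
  rw [Finset.sum_comm]
  exact Finset.sum_congr rfl fun t _ => Finset.sum_congr rfl fun i _ => mul_left_comm _ _ _

/-- With at least one site the vectors `|i ⋯ i⟩` are distinct, hence orthonormal; for `N = 0` they
would all coincide. -/
theorem norm_diagonalVector {N D : ℕ} (hN : 1 ≤ N) (α : Fin D → ℂ) :
    ‖diagonalVector N α‖ = ‖WithLp.toLp 2 α‖ := by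
  have hinj : Function.Injective fun (i : Fin D) (_ : Fin N) => i :=
    fun i j h => congrFun h ⟨0, hN⟩
  have ho : Orthonormal ℂ fun s : Fin N → Fin D => EuclideanSpace.single s (1 : ℂ) :=
    EuclideanSpace.orthonormal_single
  have h := (ho.comp _ hinj).inner_sum α α Finset.univ
  have h2 : ‖diagonalVector N α‖ ^ 2 = ‖WithLp.toLp 2 α‖ ^ 2 := by
    rw [← Complex.ofReal_inj, EuclideanSpace.norm_sq_eq (WithLp.toLp 2 α)]
    push_cast
    refine (inner_self_eq_norm_sq_to_K (𝕜 := ℂ) _).symm.trans (h.trans ?_)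
    exact Finset.sum_congr rfl fun i _ => Complex.conj_mul' _
  exact (sq_eq_sq₀ (norm_nonneg _) (norm_nonneg _)).1 h2

theorem IsDichotomic.norm_apply_le {D : ℕ} {A : Matrix (Fin D) (Fin D) ℂ} (hA : IsDichotomic A)
    (v : EuclideanSpace ℂ (Fin D)) : ‖Matrix.toEuclideanCLM (𝕜 := ℂ) A v‖ ≤ ‖v‖ := by
  have h : ∀ B : Matrix (Fin D) (Fin D) ℂ, B.PosSemidef →
      (Matrix.toEuclideanCLM (𝕜 := ℂ) B).IsPositive := fun B hB =>
    Matrix.isPositive_toEuclideanLin_iff.2 hB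
  refine ContinuousLinearMap.norm_apply_le_of_isPositive ?_ ?_ v
  · have := h _ hA.2.1
    rwa [map_sub, map_one] at this
  · have := h _ hA.2.2
    rwa [map_add, map_one] at this

end Bell

/-! ### From Q-algebras to Bell inequalities -/

/-- Neither algebra has a unit, so products are formed over nonempty sets only, and on the `S_∞`
side they are recorded through their entries. -/
theorem exists_prod_of_hom {K : Type*} [TopologicalSpace K] [CompactSpace K]
    {A : NonUnitalSubalgebra ℂ C(K, ℂ)} {π : A → SInfty} (hmul : ∀ a b, π (a * b) = π a * π b)
    {ι : Type*} {S : Finset ι} (hS : S.Nonempty) (a : ι → A) :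
    ∃ p : A, (p : C(K, ℂ)) = ∏ j ∈ S, (a j : C(K, ℂ)) ∧
      ∀ s t, Ell2.entry (π p).toCLM s t = ∏ j ∈ S, Ell2.entry (π (a j)).toCLM s t := by
  induction hS using Finset.Nonempty.cons_induction with
  | singleton j => exact ⟨a j, by simp, by simp⟩
  | cons j S hj _ ih =>
    obtain ⟨p, hp1, hp2⟩ := ih
    refine ⟨a j * p, by rw [Finset.prod_cons, ← hp1]; rfl, fun s t => ?_⟩
    rw [hmul, SInfty.entry_mul, hp2, Finset.prod_cons]

theorem SInfty.entry_sum {ι : Type*} (S : Finset ι) (f : ι → SInfty) (s t : ℕ) :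
    Ell2.entry (∑ i ∈ S, f i).toCLM s t = ∑ i ∈ S, Ell2.entry (f i).toCLM s t :=
  map_sum (AddMonoidHom.mk' (fun A : SInfty => Ell2.entry A.toCLM s t)
    fun _ _ => SInfty.entry_add _ _ _ _) f S

/-- In a Q-algebra `S_∞`, real multilinear forms act on the unit ball with a geometric bound. -/
theorem IsQAlgebra.exists_norm_le (h : IsQAlgebra SInfty) :
    ∃ K : ℝ≥0, ∀ (N M : ℕ) (T : (Fin N → Fin M) → ℝ) (x : Fin N → Fin M → SInfty), 1 ≤ N →
      Bell.classicalValue T = 1 → (∀ j i, ‖x j i‖ ≤ 1) → ∃ B : SInfty, ‖B‖ ≤ K ^ N ∧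
        ∀ s t, Ell2.entry B.toCLM s t
          = ∑ i, (T i : ℂ) * ∏ j, Ell2.entry (x j (i j)).toCLM s t := by
  obtain ⟨Ω, _, _, _, A, I, hA, -, -, Φ, hΦ⟩ := h
  have : CompleteSpace A := hA.completeSpace_coe
  let π₀ : A →ₗ[ℂ] SInfty := (Φ : (A ⧸ I) →ₗ[ℂ] SInfty) ∘ₗ I.mkQ
  have hπ₀ : Continuous π₀ := Φ.continuous.comp I.isQuotientMap_mkQ.continuous
  have hsurj : Function.Surjective π₀ := Φ.surjective.comp I.mkQ_surjective
  have hmul : ∀ a b, π₀ (a * b) = π₀ a * π₀ b := hΦ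
  let : NormedAddCommGroup A := inferInstanceAs (NormedAddCommGroup A.toSubmodule)
  let : NormedSpace ℂ A := inferInstanceAs (NormedSpace ℂ A.toSubmodule)
  let π : A →L[ℂ] SInfty := ⟨π₀, hπ₀⟩
  -- Open mapping: every element of `S_∞` has a lift of norm at most `R` times its own.
  obtain ⟨R, hR0, hR⟩ := π.exists_preimage_norm_le hsurj
  -- `π` is applied only once; replacing `‖π‖` by `max ‖π‖ 1` allows it to be absorbed into an
  -- `N`-th power.
  refine ⟨⟨max ‖π‖ 1 * (2 * R), by positivity⟩, fun N M T x hN hT hx => ?_⟩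
  choose g hg hgn using hR
  have hgx : ∀ j i, ‖g (x j i)‖ ≤ R := fun j i =>
    (hgn _).trans (mul_le_of_le_one_right hR0.le (hx j i))
  have huniv : (Finset.univ : Finset (Fin N)).Nonempty := ⟨⟨0, hN⟩, Finset.mem_univ _⟩
  choose p hp1 hp2 using fun i : Fin N → Fin M =>
    exists_prod_of_hom hmul huniv fun j => g (x j (i j))
  let b : A := ∑ i, (T i : ℂ) • p i
  have hb : ‖b‖ ≤ (2 * R) ^ N := by
    change ‖(b : C(Ω, ℂ))‖ ≤ _
    rw [ContinuousMap.norm_le _ (by positivity)]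
    intro ω
    have h1 : (b : C(Ω, ℂ)) ω = ∑ i, (T i : ℂ) * ∏ j, (g (x j (i j)) : C(Ω, ℂ)) ω := by
      have h2 : (b : C(Ω, ℂ)) = ∑ i, (T i : ℂ) • (p i : C(Ω, ℂ)) :=
        map_sum A.toSubmodule.subtype (fun i => (T i : ℂ) • p i) Finset.univ
      rw [h2]
      simp [hp1]
    rw [h1]
    refine (Bell.norm_sum_le_pow_mul_classicalValue T hR0 (z := fun j i =>
      (g (x j i) : C(Ω, ℂ)) ω) fun j i => ?_).trans_eq (by rw [hT, mul_one])
    exact ((g (x j i) : C(Ω, ℂ)).norm_coe_le_norm ω).trans (hgx j i)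
  refine ⟨π b, ?_, fun s t => ?_⟩
  · calc ‖π b‖ ≤ ‖π‖ * ‖b‖ := π.le_opNorm b
      _ ≤ max ‖π‖ 1 ^ N * (2 * R) ^ N := by
        gcongr
        exact (le_max_left _ _).trans (le_self_pow₀ (le_max_right _ _) (by lia))
      _ = _ := by rw [← mul_pow]; rfl
  · rw [map_sum, SInfty.entry_sum]
    refine Finset.sum_congr rfl fun i _ => ?_
    rw [map_smul, SInfty.entry_smul]
    congr 1
    refine (hp2 i s t).trans (Finset.prod_congr rfl fun j _ => ?_)
    rw [show π₀ (g (x j (i j))) = x j (i j) from hg _]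

theorem IsQAlgebra.exists_largestViolation_le (h : IsQAlgebra SInfty) :
    ∃ K : ℝ≥0, ∀ (N D : ℕ) (α : Fin D → ℂ), 1 ≤ N → ‖Bell.diagonalVector N α‖ = 1 →
      Bell.largestViolation (Bell.pureState (Bell.diagonalVector N α)) ≤ (K : ℝ≥0∞) ^ N := by
  obtain ⟨K, hK⟩ := h.exists_norm_le
  refine ⟨K, fun N D α hN hα => ?_⟩
  refine iSup_le fun M => iSup_le fun T => iSup_le fun hT => iSup_le fun A => iSup_le fun hA => ?_
  obtain ⟨B, hB, hBe⟩ := hK N M T (fun j i => SInfty.ofMatrix (A j i)) hN hT fun j i =>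
    SInfty.norm_ofMatrix_le (hA j i).norm_apply_le
  rw [← ENNReal.coe_pow, ENNReal.ofReal_le_coe, NNReal.coe_pow]
  · refine le_trans ?_ hB
    rw [Bell.norm_diagonalVector hN] at hα
    -- The quantum value is the quadratic form of `B` at the unit vector `α`, hence at most `‖B‖`.
    have h1 : Bell.quantumValue T (Bell.pureState (Bell.diagonalVector N α)) A
        = ‖⟪Ell2.incl D (WithLp.toLp 2 α), B.toCLM (Ell2.incl D (WithLp.toLp 2 α))⟫_ℂ‖ := by
      rw [Bell.quantumValue_diagonalVector, Ell2.inner_incl]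
      simp only [hBe, SInfty.entry_ofMatrix]
    rw [h1]
    refine (norm_inner_le_norm _ _).trans ?_
    rw [LinearIsometry.norm_map, hα, one_mul]
    refine (B.toCLM.le_opNorm _).trans_eq ?_
    rw [LinearIsometry.norm_map, hα, mul_one, SInfty.norm_def]

/-! ### From Bell inequalities to Q-algebras -/

namespace Ell2

theorem trunc_eq_incl (m : ℕ) (x : Ell2) :
    trunc m x = incl m (WithLp.toLp 2 fun i : Fin m => x i) := by
  rw [trunc_apply, incl_apply, ← Fin.sum_univ_eq_sum_range (fun i => x i • e i)]

/-- Truncations converge strongly, so the estimate on finitely supported vectors passes to all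
pairs; then test `B x` against itself. -/
theorem opNorm_le_of_inner_incl_le {B : Ell2 →L[ℂ] Ell2} {c : ℝ} (hc : 0 ≤ c)
    (h : ∀ (m : ℕ) (u v : EuclideanSpace ℂ (Fin m)),
      ‖⟪incl m u, B (incl m v)⟫_ℂ‖ ≤ c * ‖u‖ * ‖v‖) : ‖B‖ ≤ c := by
  have key : ∀ x y, ‖⟪y, B x⟫_ℂ‖ ≤ c * ‖y‖ * ‖x‖ := by
    intro x y
    have hlim : Filter.Tendsto (fun m => ‖⟪trunc m y, B (trunc m x)⟫_ℂ‖) Filter.atTop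
        (nhds ‖⟪y, B x⟫_ℂ‖) :=
      ((tendsto_trunc y).inner ((B.continuous.tendsto x).comp (tendsto_trunc x))).norm
    refine le_of_tendsto' hlim fun m => ?_
    have hy := norm_trunc_le m y
    have hx := norm_trunc_le m x
    refine le_trans ?_ (show c * ‖trunc m y‖ * ‖trunc m x‖ ≤ _ by gcongr)
    rw [trunc_eq_incl, trunc_eq_incl, LinearIsometry.norm_map, LinearIsometry.norm_map]
    exact h m _ _
  refine B.opNorm_le_bound hc fun x => ?_
  have h1 := key x (B x)
  rw [inner_self_eq_norm_sq_to_K, norm_pow, RCLike.norm_ofReal, abs_norm] at h1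
  rcases (norm_nonneg (B x)).eq_or_lt with h0 | h0
  · rw [← h0]
    positivity
  · refine le_of_mul_le_mul_left ?_ h0
    linarith

end Ell2

/-! ### Self-adjoint dilations and bounds for Schur-product forms -/

namespace Bell

/-- The self-adjoint dilation `[[0, x], [xᴴ, 0]]` of a matrix. -/
def dilation {m : ℕ} (x : Matrix (Fin m) (Fin m) ℂ) : Matrix (Fin (m + m)) (Fin (m + m)) ℂ :=
  (Matrix.fromBlocks 0 x xᴴ 0).submatrix finSumFinEquiv.symm finSumFinEquiv.symm

/-- Up to reindexing, `1 ± dilation x` is the block matrix `[[1, ±x], [±xᴴ, 1]]`, whose Schur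
complement is `1 - xᴴ x`; this is positive because `x` is a contraction. -/
theorem isDichotomic_dilation {m : ℕ} {x : Matrix (Fin m) (Fin m) ℂ}
    (hx : ∀ v, ‖Matrix.toEuclideanCLM (𝕜 := ℂ) x v‖ ≤ ‖v‖) : IsDichotomic (dilation x) := by
  have h1 : (1 - xᴴ * x).PosSemidef := by
    rw [← Matrix.isPositive_toEuclideanLin_iff]
    refine ⟨Matrix.isSymmetric_toEuclideanLin_iff.2 ?_, fun v => ?_⟩
    · exact Matrix.isHermitian_one.sub (Matrix.isHermitian_conjTranspose_mul_self x)
    · have h2 : Matrix.toEuclideanLin (1 - xᴴ * x) v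
          = v - ContinuousLinearMap.adjoint (Matrix.toEuclideanCLM (𝕜 := ℂ) x)
              (Matrix.toEuclideanCLM (𝕜 := ℂ) x v) := by
        have h3 : Matrix.toEuclideanCLM (𝕜 := ℂ) (1 - star x * x)
            = 1 - star (Matrix.toEuclideanCLM (𝕜 := ℂ) x) * Matrix.toEuclideanCLM (𝕜 := ℂ) x := by
          rw [map_sub, map_one, map_mul, map_star]
        exact congrArg (fun L => L v) h3
      rw [h2, inner_sub_left, map_sub, ContinuousLinearMap.adjoint_inner_left,
        inner_self_eq_norm_sq, inner_self_eq_norm_sq, sub_nonneg]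
      have := hx v
      gcongr
  have hblock : ∀ y : Matrix (Fin m) (Fin m) ℂ, (1 - yᴴ * y).PosSemidef →
      (Matrix.fromBlocks 1 y yᴴ 1).PosSemidef := by
    intro y hy
    have : Invertible (1 : Matrix (Fin m) (Fin m) ℂ) := invertibleOne
    rw [Matrix.PosDef.fromBlocks₁₁ y 1 Matrix.PosDef.one]
    simpa using hy
  have hone : (1 : Matrix (Fin (m + m)) (Fin (m + m)) ℂ)
      = (Matrix.fromBlocks 1 0 0 1).submatrix finSumFinEquiv.symm finSumFinEquiv.symm := by
    rw [Matrix.fromBlocks_one, Matrix.submatrix_one_equiv]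
  refine ⟨?_, ?_, ?_⟩
  · refine Matrix.IsHermitian.submatrix ?_ _
    rw [Matrix.IsHermitian, Matrix.fromBlocks_conjTranspose]
    simp
  · rw [hone]
    refine Matrix.PosSemidef.submatrix
      (M := Matrix.fromBlocks 1 0 0 1 - Matrix.fromBlocks 0 x xᴴ 0) ?_ _
    rw [sub_eq_add_neg, Matrix.fromBlocks_neg, Matrix.fromBlocks_add]
    convert hblock (-x) (by simpa using h1) using 2 <;> simp
  · rw [hone]
    refine Matrix.PosSemidef.submatrix
      (M := Matrix.fromBlocks 1 0 0 1 + Matrix.fromBlocks 0 x xᴴ 0) ?_ _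
    rw [Matrix.fromBlocks_add]
    convert hblock x h1 using 2 <;> simp

/-- The form `(u, v) ↦ ⟨u, (∑ T i x^1_{i 1} ⋯ x^n_{i n}) v⟩`, for the Schur product. -/
def schurForm {n M m : ℕ} (T : (Fin n → Fin M) → ℂ)
    (x : Fin n → Fin M → Matrix (Fin m) (Fin m) ℂ) (u v : EuclideanSpace ℂ (Fin m)) : ℂ :=
  ∑ s, ∑ t, star (u s) * v t * ∑ i, T i * ∏ j, x j (i j) s t

theorem schurForm_smul {n M m : ℕ} (T : (Fin n → Fin M) → ℂ)
    (x : Fin n → Fin M → Matrix (Fin m) (Fin m) ℂ) (u v : EuclideanSpace ℂ (Fin m)) (a b : ℂ) :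
    schurForm T x (a • u) (b • v) = star a * b * schurForm T x u v := by
  simp only [schurForm, Finset.mul_sum]
  refine Finset.sum_congr rfl fun s _ => Finset.sum_congr rfl fun t _ =>
    Finset.sum_congr rfl fun i _ => ?_
  simp only [PiLp.smul_apply, smul_eq_mul, star_mul']
  ring

/-- Entrywise products keep the block pattern of the dilation: the diagonal blocks stay zero because
`n ≥ 1`, and the two off-diagonal blocks contribute the form and its complex conjugate. -/
theorem quantumValue_dilation {n M m : ℕ} (hn : 1 ≤ n) (T : (Fin n → Fin M) → ℝ)
    (x : Fin n → Fin M → Matrix (Fin m) (Fin m) ℂ) (u v : EuclideanSpace ℂ (Fin m)) :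
    quantumValue T (pureState (diagonalVector n (Fin.append u v)))
        (fun j i => dilation (x j i))
      = |2 * (schurForm (fun i => (T i : ℂ)) x u v).re| := by
  have hn0 : n ≠ 0 := by lia
  have hconj : ∑ s, ∑ t, star (v s) * u t * ∑ i, (T i : ℂ) * ∏ j, star (x j (i j) t s)
      = star (schurForm (fun i => (T i : ℂ)) x u v) := by
    rw [schurForm, Finset.sum_comm]
    simp only [star_sum, star_mul', star_prod, star_star]
    refine Finset.sum_congr rfl fun s _ => Finset.sum_congr rfl fun t _ => ?_
    rw [mul_comm (star (v t))]
    simp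
  rw [quantumValue_diagonalVector]
  simp only [Fin.sum_univ_add, Fin.append_left, Fin.append_right, dilation, Matrix.submatrix_apply,
    finSumFinEquiv_symm_apply_castAdd, finSumFinEquiv_symm_apply_natAdd,
    Matrix.fromBlocks_apply₁₁, Matrix.fromBlocks_apply₁₂, Matrix.fromBlocks_apply₂₁,
    Matrix.fromBlocks_apply₂₂, Matrix.zero_apply, Finset.prod_const,
    Finset.card_univ, Fintype.card_fin, zero_pow hn0, mul_zero, Finset.sum_const_zero, zero_add,
    add_zero, Matrix.conjTranspose_apply]
  rw [hconj, ← schurForm, Complex.star_def, Complex.add_conj, Complex.norm_real, Real.norm_eq_abs]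

/-- Diagonal `N`-partite states induce violations of at most `K ^ N`. -/
def DiagonalViolationBound (K : ℝ≥0) : Prop :=
  ∀ (N D : ℕ) (α : Fin D → ℂ), 1 ≤ N → ‖diagonalVector N α‖ = 1 →
    largestViolation (pureState (diagonalVector N α)) ≤ (K : ℝ≥0∞) ^ N

theorem abs_re_schurForm_le {K : ℝ≥0} (hK : DiagonalViolationBound K) {n M m : ℕ}
    (hn : 1 ≤ n) {T : (Fin n → Fin M) → ℝ}
    (hT : classicalValue T ≤ 1) {x : Fin n → Fin M → Matrix (Fin m) (Fin m) ℂ}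
    (hx : ∀ j i v, ‖Matrix.toEuclideanCLM (𝕜 := ℂ) (x j i) v‖ ≤ ‖v‖)
    {u v : EuclideanSpace ℂ (Fin m)} (huv : ‖u‖ ^ 2 + ‖v‖ ^ 2 = 1) :
    |2 * (schurForm (fun i => (T i : ℂ)) x u v).re| ≤ K ^ n := by
  rw [← quantumValue_dilation hn]
  have hα : ‖diagonalVector n (Fin.append u v)‖ = 1 := by
    rw [norm_diagonalVector hn, ← sq_eq_sq₀ (norm_nonneg _) zero_le_one, one_pow, ← huv,
      EuclideanSpace.norm_sq_eq, EuclideanSpace.norm_sq_eq, EuclideanSpace.norm_sq_eq,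
      Fin.sum_univ_add]
    simp only [Fin.append_left, Fin.append_right]
  refine (quantumValue_le_of_largestViolation_le T (hK n _ _ hn hα) fun j i =>
    isDichotomic_dilation (hx j i)).trans ?_
  exact mul_le_of_le_one_right (by positivity) hT

theorem norm_schurForm_ofReal_le {K : ℝ≥0} (hK : DiagonalViolationBound K) {n M m : ℕ}
    (hn : 1 ≤ n) {T : (Fin n → Fin M) → ℝ}
    (hT : classicalValue T ≤ 1) {x : Fin n → Fin M → Matrix (Fin m) (Fin m) ℂ}
    (hx : ∀ j i v, ‖Matrix.toEuclideanCLM (𝕜 := ℂ) (x j i) v‖ ≤ ‖v‖)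
    (u v : EuclideanSpace ℂ (Fin m)) :
    ‖schurForm (fun i => (T i : ℂ)) x u v‖ ≤ K ^ n * ‖u‖ * ‖v‖ := by
  set S := schurForm (fun i => (T i : ℂ)) x u v with hS
  rcases eq_or_ne S 0 with h0 | h0
  · rw [h0, norm_zero]
    positivity
  have hu : ‖u‖ ≠ 0 := fun h => h0 (by
    rw [hS, norm_eq_zero.1 h]
    simp [schurForm])
  have hv : ‖v‖ ≠ 0 := fun h => h0 (by
    rw [hS, norm_eq_zero.1 h]
    simp [schurForm])
  have hSn : ‖S‖ ≠ 0 := norm_ne_zero_iff.2 h0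
  have h2 : (√2)⁻¹ * (√2)⁻¹ = (1 / 2 : ℝ) := by
    rw [← mul_inv, Real.mul_self_sqrt (by norm_num)]
    norm_num
  -- Both vectors are rescaled to norm `1 / √2`, so that `u ⊕ v` is a unit vector, and `v` absorbs
  -- the phase that makes the form real and nonnegative. The product of the two factors `1 / √2`
  -- cancels the `2` in front of the real part.
  set a : ℂ := (((√2)⁻¹ * ‖u‖⁻¹ : ℝ) : ℂ) with ha
  set b : ℂ := (((√2)⁻¹ * ‖v‖⁻¹ * ‖S‖⁻¹ : ℝ) : ℂ) * star S with hb
  have h := abs_re_schurForm_le hK hn hT hx (u := a • u) (v := b • v) (by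
    rw [norm_smul, norm_smul, ha, hb, norm_mul, Complex.norm_real, Complex.norm_real, norm_star,
      Real.norm_of_nonneg (by positivity), Real.norm_of_nonneg (by positivity)]
    field_simp
    rw [Real.sq_sqrt (by norm_num)]
    norm_num)
  have h3 : schurForm (fun i => (T i : ℂ)) x (a • u) (b • v)
      = ((1 / 2 * ‖u‖⁻¹ * ‖v‖⁻¹ * ‖S‖ : ℝ) : ℂ) := by
    have h4 : star S * S = ((‖S‖ ^ 2 : ℝ) : ℂ) := by
      rw [Complex.ofReal_pow]
      exact Complex.conj_mul' S
    rw [schurForm_smul, ← hS, ha, hb, Complex.star_def, Complex.conj_ofReal, ← mul_assoc,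
      mul_assoc _ ((starRingEnd ℂ) S) S, ← Complex.star_def, h4, ← Complex.ofReal_mul, ← Complex.ofReal_mul, ← h2]
    congr 1
    field_simp
  rw [h3, Complex.ofReal_re, abs_of_nonneg (by positivity)] at h
  calc ‖S‖ = 2 * (1 / 2 * ‖u‖⁻¹ * ‖v‖⁻¹ * ‖S‖) * ‖u‖ * ‖v‖ := by field_simp
    _ ≤ K ^ n * ‖u‖ * ‖v‖ := by gcongr

/-- At sign vectors the forms with coefficients `Re T` and `Im T` are the real and imaginary parts
of the form of `T`, so both have classical value at most `1`. Splitting `T` accordingly costs the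
factor `2`. -/
theorem norm_schurForm_le {K : ℝ≥0} (hK : DiagonalViolationBound K) {n M m : ℕ}
    (hn : 1 ≤ n) {T : (Fin n → Fin M) → ℂ}
    (hT : PolydiscBound T 1) {x : Fin n → Fin M → Matrix (Fin m) (Fin m) ℂ}
    (hx : ∀ j i v, ‖Matrix.toEuclideanCLM (𝕜 := ℂ) (x j i) v‖ ≤ ‖v‖)
    (u v : EuclideanSpace ℂ (Fin m)) :
    ‖schurForm T x u v‖ ≤ 2 * K ^ n * ‖u‖ * ‖v‖ := by
  have hsign : ∀ ε : Fin n → Fin M → ℤˣ,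
      ‖∑ i, T i * ((∏ j, ((ε j (i j) : ℤ) : ℝ) : ℝ) : ℂ)‖ ≤ 1 := by
    intro ε
    have h := hT (fun j i => ((ε j i : ℤ) : ℂ)) fun j i => by
      rcases Int.units_eq_one_or (ε j i) with h | h <;> simp [h]
    simpa using h
  have hre : classicalValue (fun i => (T i).re) ≤ 1 := ciSup_le fun ε => by
    refine le_trans (le_of_eq ?_) ((Complex.abs_re_le_norm _).trans (hsign ε))
    rw [Complex.re_sum]
    simp only [Complex.re_mul_ofReal]
  have him : classicalValue (fun i => (T i).im) ≤ 1 := ciSup_le fun ε => by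
    refine le_trans (le_of_eq ?_) ((Complex.abs_im_le_norm _).trans (hsign ε))
    rw [Complex.im_sum]
    simp only [Complex.im_mul_ofReal]
  have hsplit : schurForm T x u v = schurForm (fun i => ((T i).re : ℂ)) x u v
      + Complex.I * schurForm (fun i => ((T i).im : ℂ)) x u v := by
    simp only [schurForm, Finset.mul_sum, ← Finset.sum_add_distrib]
    refine Finset.sum_congr rfl fun s _ => Finset.sum_congr rfl fun t _ =>
      Finset.sum_congr rfl fun i _ => ?_
    conv_lhs => rw [← Complex.re_add_im (T i)]
    ring
  rw [hsplit]
  refine (norm_add_le _ _).trans ?_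
  rw [norm_mul, Complex.norm_I, one_mul]
  have h1 := norm_schurForm_ofReal_le hK hn hre hx u v
  have h2 := norm_schurForm_ofReal_le hK hn him hx u v
  linarith

end Bell

/-! ### Davie's condition for `S_∞` -/

namespace SInfty

/-- Matrix entries are multiplicative functionals. -/
def entryHom (s t : ℕ) : SInfty →ₙₐ[ℂ] ℂ where
  toFun A := Ell2.entry A.toCLM s t
  map_smul' c A := entry_smul c A s t
  map_zero' := entry_zero s t
  map_add' A B := entry_add A B s t
  map_mul' A B := entry_mul A B s t

/-- Matrix entries are characters of `S_∞` and extend to the unitization; as `n ≥ 1`, the sum has no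
scalar part, so the extension reads off the entry itself. -/
theorem entry_snd_sum {n M : ℕ} (hn : 1 ≤ n) (T : (Fin n → Fin M) → ℂ)
    (x : Fin n → Fin M → SInfty) (s t : ℕ) :
    Ell2.entry (∑ i, T i • ∏ j, (x j (i j) : Unitization ℂ SInfty)).snd.toCLM s t
      = ∑ i, T i * ∏ j, Ell2.entry (x j (i j)).toCLM s t := by
  set a : Unitization ℂ SInfty := ∑ i, T i • ∏ j, (x j (i j) : Unitization ℂ SInfty) with ha
  have hfst : a.fst = 0 := by
    change Unitization.fstHom ℂ SInfty a = 0
    rw [ha, map_sum]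
    refine Finset.sum_eq_zero fun i _ => ?_
    rw [map_smul, map_prod, Finset.prod_eq_zero (Finset.mem_univ (⟨0, hn⟩ : Fin n)), smul_zero]
    exact Unitization.fst_inr ℂ (x ⟨0, hn⟩ (i ⟨0, hn⟩))
  have hlift : ∀ b : Unitization ℂ SInfty,
      Unitization.lift (entryHom s t) b = b.fst + Ell2.entry b.snd.toCLM s t := fun _ => rfl
  have h : Unitization.lift (entryHom s t) a = Ell2.entry a.snd.toCLM s t := by
    rw [hlift, hfst, zero_add]
  rw [← h, ha, map_sum]
  refine Finset.sum_congr rfl fun i _ => ?_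
  rw [map_smul, map_prod, smul_eq_mul]
  congr 1
  refine Finset.prod_congr rfl fun j _ => ?_
  rw [hlift, Unitization.fst_inr, zero_add, Unitization.snd_inr]

/-- Since `n ≥ 1`, the prefactor in `2 * K ^ n` is absorbed into `(2 * K) ^ n`; the added `1` keeps
the constant positive even for `K = 0`, as the Q-algebra criterion requires. -/
theorem davieCondition {K : ℝ≥0} (hK : Bell.DiagonalViolationBound K) :
    DavieCondition SInfty (2 * K + 1) := by
  intro n M T x hn hx hT
  rw [norm_def]
  refine (Ell2.opNorm_le_of_inner_incl_le (c := 2 * K ^ n) (by positivity) fun m u v => ?_).trans ?_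
  · have h := Bell.norm_schurForm_le hK hn hT (x := fun j i => Ell2.corner m (x j i).toCLM)
      (fun j i w => (Ell2.norm_corner_apply_le _ w).trans
        (mul_le_of_le_one_left (norm_nonneg w) (hx j i))) u v
    convert h using 2
    rw [Ell2.inner_incl, Bell.schurForm]
    simp only [entry_snd_sum hn]
    rfl
  · calc (2 * K ^ n : ℝ) ≤ 2 ^ n * K ^ n := by
          gcongr
          exact le_self_pow₀ one_le_two (by lia)
      _ = (2 * K) ^ n := (mul_pow _ _ _).symm
      _ ≤ (2 * K + 1) ^ n := by
          gcongr
          linarith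

end SInfty

end

theorem mainTheorem8 :
    IsQAlgebra SInfty ↔
      ∃ K : ℝ≥0, ∀ (N D : ℕ) (α : Fin D → ℂ), 1 ≤ N → ‖Bell.diagonalVector N α‖ = 1 →
        Bell.largestViolation (Bell.pureState (Bell.diagonalVector N α)) ≤ (K : ℝ≥0∞) ^ N :=
  ⟨IsQAlgebra.exists_largestViolation_le, fun ⟨K, hK⟩ =>
    (SInfty.davieCondition hK).isQAlgebra (by positivity)⟩
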